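/- **Proposition 7.4.** Let $\mathbb K$ be a field and let $f : A \to B$ be a quasi-isomorphism of differential graded associative unital $\mathbb K$-algebras ($\mathbb Z$-graded, with differentials of degree $+1$). Then the two morphisms of cochain complexes $$\mathcal C^*_{\mathrm{sg}}(A,A)\xrightarrow{\ \mathcal C^*_{\mathrm{sg}}(A,f)\ }\mathcal C^*_{\mathrm{sg}}(A,B)\xleftarrow{\ \mathcal C^*_{\mathrm{sg}}(f,B)\ }\mathcal C^*_{\mathrm{sg}}(B,B)$$ between singular Hochschild cochain complexes, defined as follows, are both quasi-isomorphisms. *Notation.* Write $\overline A = A/(\mathbb K\cdot 1)$, and let $s\overline A$ be its shift: $(s\overline A)^n=\overline A^{\,n+1}$, with differential $\overline a\mapsto-\overline{da}$. Here $\overline a$ denotes the class of $a$ in $s\overline A$, of degree $\deg a-1$. Tensor products are over $\mathbb K$ and carry the usual differential $d(x\otimes y)=dx\otimes y+(-1)^{\deg x}x\otimes dy$. *Differential forms.* Put $\Omega^0(A)=A$ and $\Omega^{p+1}(A)=s\overline A\otimes\Omega^p(A)$, so that $\Omega^p(A)=(s\overline A)^{\otimes p}\otimes A$ as a complex. It is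 a dg $A$-$A$-bimodule. The right action is multiplication on the last factor. The left action is multiplication for $p=0$, and for $p \ge 0$ it is given on $\Omega^{p+1}(A)$ by $$a\cdot(\overline x\otimes w)=(-1)^{\deg a}\bigl(\overline{ax}\otimes w-\overline a\otimes(x\cdot w)\bigr),\qquad w\in\Omega^p(A).$$ The morphism $f$ induces $\Omega^p(f):\Omega^p(A)\to\Omega^p(B)$, $\overline{a_1}\otimes\cdots\otimes\overline{a_p}\otimes a_{p+1}\mapsto\overline{f(a_1)}\otimes\cdots\otimes\overline{f(a_p)}\otimes f(a_{p+1})$. Via $f$, the bimodule $\Omega^p(B)$ is also an $A$-$A$-bimodule. *Hochschild cochains.* For a dg $A$-$A$-bimodule $M$, let $C^n(A,M)=\prod_{m\ge0}\mathrm{Hom}_{\mathbb K}((s\overline A)^{\otimes m},M)^n$, where $\mathrm{Hom}(-,-)^n$ is the space of linear maps of degree $n$. The differential is $\delta=\delta^v+\delta^h$, where for $g\in\mathrm{Hom}_{\mathbb K}((s\overline A)^{\otimes m},M)^n$, $a\in A$ and $t\in(s\overline A)^{\otimes m}$, $$\delta^v g=d\circ g-(-1)^n g\circ d,\qquad \delta^h(g)(\overline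 a\otimes t)=-(-1)^n\bigl((-1)^{n\deg a}\,a\cdot g(t)-\widetilde g(a\cdot(t\otimes1))\bigr).$$ Here $\widetilde g:\Omega^m(A)=(s\overline A)^{\otimes m}\otimes A\to M$ is $\widetilde g(t\otimes b)=g(t)\cdot b$, and $a\cdot(t\otimes 1)$ is the left action on $\Omega^m(A)$. *Singular Hochschild cochains.* Let $$\mathcal C^*_{\mathrm{sg}}(A,B)=\varinjlim_{p\ge0}C^*(A,\Omega^p(B)),$$ the colimit of cochain complexes along the morphisms $\theta^p_{A,B}:C^*(A,\Omega^p(B))\to C^*(A,\Omega^{p+1}(B))$ that send $g\in\mathrm{Hom}_{\mathbb K}((s\overline A)^{\otimes m},\Omega^p(B))^n$ to the element of $\mathrm{Hom}_{\mathbb K}((s\overline A)^{\otimes m+1},\Omega^{p+1}(B))^n$ given by $$\overline a\otimes t\mapsto(-1)^{n(\deg a-1)}\,\overline{f(a)}\otimes g(t).$$ The complexes $\mathcal C^*_{\mathrm{sg}}(A,A)$ and $\mathcal C^*_{\mathrm{sg}}(B,B)$ are the cases of $\mathrm{id}_A$ and $\mathrm{id}_B$. Finally, $\mathcal C^*_{\mathrm{sg}}(A,f)$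 is the colimit over $p$ of the maps $C^*(A,\Omega^p(A))\to C^*(A,\Omega^p(B))$ given by composition with $\Omega^p(f)$. Likewise, $\mathcal C^*_{\mathrm{sg}}(f,B)$ is the colimit over $p$ of the maps $C^*(B,\Omega^p(B))\to C^*(A,\Omega^p(B))$ given by precomposition with $(s\overline A)^{\otimes m}\to(s\overline B)^{\otimes m}$, $\overline{a_1}\otimes\cdots\otimes\overline{a_m}\mapsto\overline{f(a_1)}\otimes\cdots\otimes\overline{f(a_m)}$. -/

import Mathlib

open CategoryTheory Limits
open scoped TensorProduct DirectSum

universe u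

noncomputable section

/-- The sign `(-1)^n`, for an integer `n`, as an element of the ring `K`. -/
def koszulSign (K : Type u) [CommRing K] (n : ℤ) : K := ((n.negOnePow : ℤ) : K)

section koszulSign

variable (K : Type u) [CommRing K]

@[simp] theorem koszulSign_zero : koszulSign K 0 = 1 := by simp [koszulSign]

@[simp] theorem koszulSign_one : koszulSign K 1 = -1 := by simp [koszulSign]

theorem koszulSign_add (m n : ℤ) :
    koszulSign K (m + n) = koszulSign K m * koszulSign K n := by
  simp [koszulSign, Int.negOnePow_add]

@[simp] theorem koszulSign_mul_self (n : ℤ) : koszulSign K n * koszulSign K n = 1 := by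
  rw [← koszulSign_add, koszulSign, Int.negOnePow_even _ ⟨n, rfl⟩]; simp

theorem koszulSign_succ (n : ℤ) : koszulSign K (n + 1) = -koszulSign K n := by
  simp [koszulSign_add]

theorem koszulSign_pred (n : ℤ) : koszulSign K (n - 1) = -koszulSign K n := by
  have h := koszulSign_succ K (n - 1)
  rw [sub_add_cancel] at h
  rw [h, neg_neg]

end koszulSign

/-- A differential graded `K`-module, that is, a cochain complex of `K`-modules `M`, written as
the direct sum `M = ⨁ n, gr n` of its homogeneous parts with a differential of degree one. -/
structure DGMod (K : Type u) [CommRing K] where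
  carrier : Type u
  [addCommGroup : AddCommGroup carrier]
  [module : Module K carrier]
  gr : ℤ → Submodule K carrier
  [decomp : DirectSum.Decomposition gr]
  d : carrier →ₗ[K] carrier
  d_mem : ∀ {n : ℤ} {x : carrier}, x ∈ gr n → d x ∈ gr (n + 1)
  d_d : ∀ x : carrier, d (d x) = 0

attribute [instance] DGMod.addCommGroup DGMod.module DGMod.decomp

instance (K : Type u) [CommRing K] : CoeSort (DGMod K) (Type u) := ⟨DGMod.carrier⟩

namespace DGMod

variable {K : Type u} [CommRing K]

/-- Two linear maps that agree on homogeneous elements are equal. -/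
theorem hom_ext (M : DGMod K) {N : Type u} [AddCommGroup N] [Module K N] {f g : M →ₗ[K] N}
    (h : ∀ (i : ℤ) (x : M), x ∈ M.gr i → f x = g x) : f = g := by
  ext x
  induction x using DirectSum.Decomposition.inductionOn M.gr with
  | zero => simp
  | homogeneous x => exact h _ _ x.2
  | add x y hx hy => simp [hx, hy]

/-- The linear map `x ↦ (-1)^(n * deg x) x`. -/
def sgn (M : DGMod K) (n : ℤ) : M →ₗ[K] M :=
  (DirectSum.toModule K ℤ M fun i => koszulSign K (n * i) • (M.gr i).subtype) ∘ₗ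
    (DirectSum.decomposeLinearEquiv M.gr).toLinearMap

theorem sgn_of_mem (M : DGMod K) (n : ℤ) {i : ℤ} {x : M} (hx : x ∈ M.gr i) :
    M.sgn n x = koszulSign K (n * i) • x := by
  simp only [sgn, LinearMap.comp_apply, LinearEquiv.coe_coe, DirectSum.decomposeLinearEquiv_apply]
  rw [DirectSum.decompose_of_mem _ hx]
  exact (DirectSum.toModule_lof K i _).trans (by simp)

theorem sgn_mem (M : DGMod K) (n : ℤ) {i : ℤ} {x : M} (hx : x ∈ M.gr i) :
    M.sgn n x ∈ M.gr i := by
  rw [sgn_of_mem M n hx]; exact Submodule.smul_mem _ _ hx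

theorem sgn_d (M : DGMod K) (n : ℤ) (x : M) :
    M.sgn n (M.d x) = koszulSign K n • M.d (M.sgn n x) := by
  have : M.sgn n ∘ₗ M.d = koszulSign K n • (M.d ∘ₗ M.sgn n) := M.hom_ext fun i x hx => by
    simp [sgn_of_mem M n hx, sgn_of_mem M n (M.d_mem hx), mul_add, koszulSign_add, smul_smul,
      mul_comm]
  exact LinearMap.congr_fun this x

theorem sgn_succ (M : DGMod K) (n : ℤ) (x : M) :
    M.sgn (n + 1) x = M.sgn n (M.sgn 1 x) := by
  have : M.sgn (n + 1) = M.sgn n ∘ₗ M.sgn 1 := M.hom_ext fun i x hx => by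
    rw [LinearMap.comp_apply, sgn_of_mem M _ hx, sgn_of_mem M 1 hx, map_smul, sgn_of_mem M n hx,
      add_mul, koszulSign_add, smul_smul, mul_comm]
  exact LinearMap.congr_fun this x

theorem sgn_comm (M : DGMod K) (n : ℤ) (x : M) :
    M.sgn 1 (M.sgn n x) = M.sgn n (M.sgn 1 x) := by
  have : M.sgn 1 ∘ₗ M.sgn n = M.sgn n ∘ₗ M.sgn 1 := M.hom_ext fun i x hx => by
    simp [sgn_of_mem M _ hx, smul_smul, mul_comm]
  exact LinearMap.congr_fun this x

@[simp] theorem sgn_sgn (M : DGMod K) (n : ℤ) (x : M) : M.sgn n (M.sgn n x) = x := by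
  have : M.sgn n ∘ₗ M.sgn n = LinearMap.id := M.hom_ext fun i x hx => by
    simp [sgn_of_mem M _ hx, smul_smul]
  exact LinearMap.congr_fun this x

/-- The underlying cochain complex `⋯ → gr n → gr (n + 1) → ⋯` of `K`-modules. -/
def toComplex (M : DGMod K) : CochainComplex (ModuleCat.{u} K) ℤ :=
  CochainComplex.of (fun n => ModuleCat.of K (M.gr n))
    (fun _ => ModuleCat.ofHom (M.d.restrict fun _ hx => M.d_mem hx))
    (fun _ => ModuleCat.hom_ext (LinearMap.ext fun x => Subtype.ext (M.d_d x.1)))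

/-- The ring `K`, placed in degree zero. -/
@[reducible] def unit (K : Type u) [CommRing K] : DGMod K where
  carrier := K
  gr n := if n = 0 then ⊤ else ⊥
  decomp := DirectSum.Decomposition.ofLinearMap _
    (DirectSum.lof K ℤ (fun n : ℤ => ((if n = 0 then ⊤ else ⊥ : Submodule K K))) 0 ∘ₗ
      LinearMap.codRestrict _ LinearMap.id (fun _ => by simp))
    (by ext; simp)
    (by
      refine DirectSum.linearMap_ext _ fun i => LinearMap.ext fun x => ?_
      obtain rfl | hi := eq_or_ne i 0
      · simp
        congr
      · have h0 : x = 0 := Subtype.ext (by simpa [hi] using x.2)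
        subst h0
        simp)
  d := 0
  d_mem _ := by simp
  d_d _ := by simp

/-- The spans of the elementary tensors of total degree `n`. -/
def tensorGr (M N : DGMod K) (n : ℤ) : Submodule K (M ⊗[K] N) :=
  Submodule.span K {z | ∃ i j : ℤ, i + j = n ∧ ∃ x ∈ M.gr i, ∃ y ∈ N.gr j, x ⊗ₜ[K] y = z}

theorem tmul_mem_tensorGr (M N : DGMod K) {i j n : ℤ} (h : i + j = n) {x : M} (hx : x ∈ M.gr i)
    {y : N} (hy : y ∈ N.gr j) : x ⊗ₜ[K] y ∈ tensorGr M N n :=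
  Submodule.subset_span ⟨i, j, h, x, hx, y, hy, rfl⟩

/-- To check a property of linear maps out of a tensor product, homogeneous tensors suffice. -/
theorem tensor_hom_ext (M N : DGMod K) {P : Type u} [AddCommGroup P] [Module K P]
    {f g : M ⊗[K] N →ₗ[K] P}
    (h : ∀ (i j : ℤ) (x : M) (y : N), x ∈ M.gr i → y ∈ N.gr j → f (x ⊗ₜ y) = g (x ⊗ₜ y)) :
    f = g := by
  apply TensorProduct.ext
  refine M.hom_ext fun i x hx => N.hom_ext fun j y hy => h i j x y hx hy

/-- The splitting of an element of `M ⊗ N` into homogeneous components. -/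
def tensorDecompose (M N : DGMod K) : M ⊗[K] N →ₗ[K] ⨁ n, tensorGr M N n :=
  TensorProduct.lift <|
    (DirectSum.toModule K ℤ _ fun i =>
      LinearMap.flip <| (DirectSum.toModule K ℤ _ fun j => LinearMap.flip <|
        LinearMap.mk₂ K (fun (x : M.gr i) (y : N.gr j) =>
          DirectSum.lof K ℤ (fun n => tensorGr M N n) (i + j)
            ⟨x.1 ⊗ₜ y.1, tmul_mem_tensorGr M N rfl x.2 y.2⟩)
          (fun x x' y => by rw [← map_add]; congr 1; ext; simp [TensorProduct.add_tmul])
          (fun c x y => by rw [← map_smul]; congr 1)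
          (fun x y y' => by rw [← map_add]; congr 1; ext; simp [TensorProduct.tmul_add])
          (fun c x y => by
            rw [← map_smul]; congr 1; ext; simp)) ∘ₗ
            (DirectSum.decomposeLinearEquiv N.gr).toLinearMap) ∘ₗ
      (DirectSum.decomposeLinearEquiv M.gr).toLinearMap

theorem tensorDecompose_tmul (M N : DGMod K) {i j n : ℤ} (h : i + j = n) {x : M} (hx : x ∈ M.gr i)
    {y : N} (hy : y ∈ N.gr j) :
    tensorDecompose M N (x ⊗ₜ y) =
      DirectSum.lof K ℤ (fun n => tensorGr M N n) n
        ⟨x ⊗ₜ y, tmul_mem_tensorGr M N h hx hy⟩ := by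
  subst h
  simp only [tensorDecompose, TensorProduct.lift.tmul, LinearMap.comp_apply, LinearEquiv.coe_coe,
    DirectSum.decomposeLinearEquiv_apply, DirectSum.decompose_of_mem _ hx, 
    DirectSum.decompose_of_mem _ hy, ← DirectSum.lof_eq_of K, DirectSum.toModule_lof,
    LinearMap.flip_apply, LinearMap.mk₂_apply]

/-- The tensor product of dg modules, with
`d (x ⊗ y) = d x ⊗ y + (-1)^(deg x) x ⊗ d y`. -/
def tensor (M N : DGMod K) : DGMod K where
  carrier := M ⊗[K] N
  gr := tensorGr M N
  decomp := DirectSum.Decomposition.ofLinearMap _ (tensorDecompose M N)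
    (tensor_hom_ext M N fun i j x y hx hy => by
      rw [LinearMap.comp_apply, tensorDecompose_tmul M N rfl hx hy]
      simp)
    (by
      refine DirectSum.linearMap_ext _ fun n => LinearMap.ext fun x => ?_
      obtain ⟨x, hx⟩ := x
      simp only [LinearMap.comp_apply, DirectSum.coeLinearMap_lof, LinearMap.id_apply]
      induction hx using Submodule.span_induction with
      | mem z hz =>
        obtain ⟨i, j, h, x, hx, y, hy, rfl⟩ := hz
        exact tensorDecompose_tmul M N h hx hy
      | zero => simp only [map_zero]; exact (map_zero _).symm
      | add x y hx hy h1 h2 =>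
        rw [map_add, h1, h2, ← map_add]; rfl
      | smul c x hx h =>
        rw [map_smul, h, ← map_smul]; rfl)
  d := TensorProduct.map M.d LinearMap.id + TensorProduct.map (M.sgn 1) N.d
  d_mem {n z} hz := by
    induction hz using Submodule.span_induction with
    | mem z hz =>
      obtain ⟨i, j, h, x, hx, y, hy, rfl⟩ := hz
      exact Submodule.add_mem _ (tmul_mem_tensorGr M N (by omega) (M.d_mem hx) hy)
        (tmul_mem_tensorGr M N (by omega) (M.sgn_mem 1 hx) (N.d_mem hy))
    | zero => simp
    | add x y _ _ h1 h2 => rw [map_add]; exact Submodule.add_mem _ h1 h2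
    | smul c x _ h => rw [map_smul]; exact Submodule.smul_mem _ _ h
  d_d z := by
    induction z using TensorProduct.induction_on with
    | zero => simp
    | tmul x y => simp [M.d_d, N.d_d, sgn_d, TensorProduct.neg_tmul]
    | add x y h1 h2 => rw [map_add, map_add, h1, h2, add_zero]

/-- The bilinear map `(x, y) ↦ x ⊗ y`. -/
def tmk (M N : DGMod K) : M →ₗ[K] N →ₗ[K] tensor M N := TensorProduct.mk K M N

/-- The linear map out of a tensor product given by a bilinear map. -/
def tlift {M N : DGMod K} {P : Type u} [AddCommGroup P] [Module K P] (f : M →ₗ[K] N →ₗ[K] P) :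
    tensor M N →ₗ[K] P := TensorProduct.lift f

@[simp] theorem tlift_tmk {M N : DGMod K} {P : Type u} [AddCommGroup P] [Module K P]
    (f : M →ₗ[K] N →ₗ[K] P) (x : M) (y : N) : tlift f (tmk M N x y) = f x y :=
  TensorProduct.lift.tmul x y

theorem tensor_ext {M N : DGMod K} {P : Type u} [AddCommGroup P] [Module K P]
    {f g : tensor M N →ₗ[K] P} (h : ∀ x y, f (tmk M N x y) = g (tmk M N x y)) : f = g :=
  TensorProduct.ext' h

theorem tmk_mem {M N : DGMod K} {i j n : ℤ} (h : i + j = n) {x : M} (hx : x ∈ M.gr i)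
    {y : N} (hy : y ∈ N.gr j) : tmk M N x y ∈ (tensor M N).gr n :=
  tmul_mem_tensorGr M N h hx hy

/-- A linear map out of a tensor product is homogeneous of degree `e` as soon as it is so on
elementary tensors of homogeneous elements. -/
theorem tensor_map_mem {M N : DGMod K} {P : Type u} [AddCommGroup P] [Module K P]
    (f : tensor M N →ₗ[K] P) {n : ℤ} (S : Submodule K P)
    (h : ∀ (i j : ℤ) (x : M) (y : N), i + j = n → x ∈ M.gr i → y ∈ N.gr j → f (tmk M N x y) ∈ S)
    {z : tensor M N} (hz : z ∈ (tensor M N).gr n) : f z ∈ S := by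
  have : (tensor M N).gr n ≤ S.comap f := Submodule.span_le.2 (by
    rintro _ ⟨i, j, hij, x, hx, y, hy, rfl⟩
    exact h i j x y hij hx hy)
  exact this hz

theorem d_tmk (M N : DGMod K) (x : M) (y : N) :
    (tensor M N).d (tmk M N x y) = tmk M N (M.d x) y + tmk M N (M.sgn 1 x) (N.d y) := rfl

theorem sgn_tmk (M N : DGMod K) (n : ℤ) (x : M) (y : N) :
    (tensor M N).sgn n (tmk M N x y) = tmk M N (M.sgn n x) (N.sgn n y) := by
  have : (tmk M N).compr₂ ((tensor M N).sgn n) = (tmk M N).compl₁₂ (M.sgn n) (N.sgn n) :=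
    M.hom_ext fun i x hx => N.hom_ext fun j y hy => by
      simp only [LinearMap.compr₂_apply, LinearMap.compl₁₂_apply,
        sgn_of_mem (tensor M N) n (tmk_mem rfl hx hy), sgn_of_mem M n hx, sgn_of_mem N n hy,
        mul_add, koszulSign_add, map_smul, LinearMap.smul_apply, smul_smul]
      rw [mul_comm]
  exact LinearMap.congr_fun (LinearMap.congr_fun this x) y

end DGMod

/-- A differential graded associative unital `K`-algebra `A = ⨁ n, gr n` (graded by the integers). -/
structure DGAlg (K : Type u) [CommRing K] where
  carrier : Type u
  [ring : Ring carrier]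
  [algebra : Algebra K carrier]
  gr : ℤ → Submodule K carrier
  [graded : GradedAlgebra gr]
  d : carrier →ₗ[K] carrier
  d_mem : ∀ {n : ℤ} {a : carrier}, a ∈ gr n → d a ∈ gr (n + 1)
  d_d : ∀ a : carrier, d (d a) = 0
  leibniz : ∀ {n : ℤ} {a : carrier} (b : carrier), a ∈ gr n →
    d (a * b) = d a * b + koszulSign K n • (a * d b)

attribute [instance] DGAlg.ring DGAlg.algebra DGAlg.graded

instance (K : Type u) [CommRing K] : CoeSort (DGAlg K) (Type u) := ⟨DGAlg.carrier⟩

namespace DGAlg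

variable {K : Type u} [CommRing K]

/-- The dg module underlying a dg algebra. -/
@[reducible] def toDGMod (A : DGAlg K) : DGMod K where
  carrier := A
  gr := A.gr
  d := A.d
  d_mem := A.d_mem
  d_d := A.d_d

/-- The linear map `a ↦ (-1)^(n * deg a) a`. -/
@[reducible] def sgn (A : DGAlg K) (n : ℤ) : A →ₗ[K] A := A.toDGMod.sgn n

theorem hom_ext (A : DGAlg K) {N : Type u} [AddCommGroup N] [Module K N] {f g : A →ₗ[K] N}
    (h : ∀ (i : ℤ) (x : A), x ∈ A.gr i → f x = g x) : f = g := A.toDGMod.hom_ext h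

theorem one_mem (A : DGAlg K) : (1 : A) ∈ A.gr 0 := SetLike.GradedOne.one_mem

theorem mul_mem (A : DGAlg K) {i j : ℤ} {a b : A} (ha : a ∈ A.gr i) (hb : b ∈ A.gr j) :
    a * b ∈ A.gr (i + j) := SetLike.GradedMul.mul_mem ha hb

theorem sgn_of_mem (A : DGAlg K) (n : ℤ) {i : ℤ} {x : A} (hx : x ∈ A.gr i) :
    A.sgn n x = koszulSign K (n * i) • x := A.toDGMod.sgn_of_mem n hx

@[simp] theorem sgn_one (A : DGAlg K) (n : ℤ) : A.sgn n (1 : A) = 1 := by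
  simp [A.sgn_of_mem n A.one_mem]

theorem sgn_mul (A : DGAlg K) (n : ℤ) (a b : A) :
    A.sgn n (a * b) = A.sgn n a * A.sgn n b := by
  have : (LinearMap.mul K A).compr₂ (A.sgn n) =
      (LinearMap.mul K A).compl₁₂ (A.sgn n) (A.sgn n) :=
    A.hom_ext fun i x hx => A.hom_ext fun j y hy => by
      simp only [LinearMap.compr₂_apply, LinearMap.compl₁₂_apply, LinearMap.mul_apply',
        A.sgn_of_mem n hx, A.sgn_of_mem n hy, A.sgn_of_mem n (A.mul_mem hx hy), mul_add,
        koszulSign_add, smul_mul_smul_comm]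
  exact LinearMap.congr_fun (LinearMap.congr_fun this a) b

theorem d_mul (A : DGAlg K) (a b : A) : A.d (a * b) = A.d a * b + A.sgn 1 a * A.d b := by
  have : (LinearMap.mul K A).compr₂ A.d =
      (LinearMap.mul K A).comp A.d + (LinearMap.mul K A).compl₁₂ (A.sgn 1) A.d :=
    A.hom_ext fun i x hx => LinearMap.ext fun y => by
      simp [A.leibniz y hx, A.sgn_of_mem 1 hx]
  exact LinearMap.congr_fun (LinearMap.congr_fun this a) b

@[simp] theorem d_one (A : DGAlg K) : A.d (1 : A) = 0 := by
  have h := A.d_mul 1 1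
  simpa using h

/-- A morphism of dg algebras. -/
structure Hom (A B : DGAlg K) where
  toAlgHom : A →ₐ[K] B
  map_mem : ∀ {n : ℤ} {a : A}, a ∈ A.gr n → toAlgHom a ∈ B.gr n
  map_d : ∀ a : A, toAlgHom (A.d a) = B.d (toAlgHom a)

/-- The identity morphism of a dg algebra. -/
@[reducible] def Hom.id (A : DGAlg K) : Hom A A := ⟨AlgHom.id K A, fun h => h, fun _ => rfl⟩

/-- The map of cochain complexes underlying a morphism of dg algebras. -/
def Hom.toComplexHom {A B : DGAlg K} (f : Hom A B) :
    A.toDGMod.toComplex ⟶ B.toDGMod.toComplex :=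
  CochainComplex.ofHom
    (fun _ => ModuleCat.ofHom (f.toAlgHom.toLinearMap.restrict fun _ hx => f.map_mem hx))
    (fun _ => by
      simp only [DGMod.toComplex, CochainComplex.of_d]
      exact ModuleCat.hom_ext (LinearMap.ext fun x => Subtype.ext (f.map_d x.1).symm))

/-- A morphism of dg algebras is a quasi-isomorphism if it induces isomorphisms on cohomology. -/
def Hom.IsQuasiIso {A B : DGAlg K} (f : Hom A B) : Prop := QuasiIso f.toComplexHom

theorem Hom.map_sgn {A B : DGAlg K} (f : Hom A B) (n : ℤ) (a : A) :
    f.toAlgHom (A.sgn n a) = B.sgn n (f.toAlgHom a) := by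
  have : f.toAlgHom.toLinearMap ∘ₗ A.sgn n = B.sgn n ∘ₗ f.toAlgHom.toLinearMap :=
    A.hom_ext fun i x hx => by
      simp [A.sgn_of_mem n hx, B.sgn_of_mem n (f.map_mem hx)]
  exact LinearMap.congr_fun this a

/-- The line `K · 1` in `A`. -/
@[reducible] def oneLine (A : DGAlg K) : Submodule K A := Submodule.span K {(1 : A)}

theorem oneLine_le_ker (A : DGAlg K) {N : Type u} [AddCommGroup N] [Module K N]
    (f : A →ₗ[K] N) (hf : f 1 = 0) : A.oneLine ≤ LinearMap.ker f := by
  rwa [Submodule.span_singleton_le_iff_mem, LinearMap.mem_ker]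

/-- The homogeneous parts of `s(A / K · 1)`; the shift lowers degrees by one. -/
def sbarGr (A : DGAlg K) (n : ℤ) : Submodule K (A ⧸ A.oneLine) :=
  (A.gr (n + 1)).map A.oneLine.mkQ

theorem mkQ_mem_sbarGr (A : DGAlg K) {i n : ℤ} (h : n + 1 = i) {a : A} (ha : a ∈ A.gr i) :
    A.oneLine.mkQ a ∈ A.sbarGr n := by
  subst h; exact Submodule.mem_map_of_mem ha

/-- The splitting of an element of `s(A / K · 1)` into homogeneous components, on lifts to `A`. -/
def sbarDecomposeAux (A : DGAlg K) : A →ₗ[K] ⨁ n, A.sbarGr n :=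
  (DirectSum.toModule K ℤ _ fun i =>
    DirectSum.lof K ℤ (fun n => A.sbarGr n) (i - 1) ∘ₗ
      (A.oneLine.mkQ.restrict fun _ ha => A.mkQ_mem_sbarGr (by omega) ha)) ∘ₗ
    (DirectSum.decomposeLinearEquiv A.gr).toLinearMap

theorem sbarDecomposeAux_of_mem (A : DGAlg K) {i n : ℤ} (h : n + 1 = i) {a : A}
    (ha : a ∈ A.gr i) : A.sbarDecomposeAux a =
      DirectSum.lof K ℤ (fun n => A.sbarGr n) n ⟨A.oneLine.mkQ a, A.mkQ_mem_sbarGr h ha⟩ := by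
  obtain rfl : n = i - 1 := by omega
  simp only [sbarDecomposeAux, LinearMap.comp_apply, LinearEquiv.coe_coe,
    DirectSum.decomposeLinearEquiv_apply, DirectSum.decompose_of_mem _ ha,
    ← DirectSum.lof_eq_of K, DirectSum.toModule_lof]
  rfl

theorem sbarDecomposeAux_one (A : DGAlg K) : A.sbarDecomposeAux 1 = 0 := by
  rw [A.sbarDecomposeAux_of_mem (n := -1) (by norm_num) A.one_mem]
  have h0 : (⟨A.oneLine.mkQ 1, A.mkQ_mem_sbarGr (n := -1) (by norm_num) A.one_mem⟩ :
      A.sbarGr (-1)) = 0 :=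
    Subtype.ext ((Submodule.Quotient.mk_eq_zero _).2 (Submodule.mem_span_singleton_self 1))
  rw [h0, map_zero]

/-- The splitting of an element of `s(A / K · 1)` into homogeneous components. -/
def sbarDecompose (A : DGAlg K) : (A ⧸ A.oneLine) →ₗ[K] ⨁ n, A.sbarGr n :=
  { QuotientAddGroup.lift A.oneLine.toAddSubgroup A.sbarDecomposeAux.toAddMonoidHom
      (fun x hx => by
        obtain ⟨c, rfl⟩ := Submodule.mem_span_singleton.1 hx
        exact (A.sbarDecomposeAux.map_smul c 1).trans (by rw [sbarDecomposeAux_one, smul_zero]))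
    with
    map_smul' := by rintro c ⟨x⟩; exact A.sbarDecomposeAux.map_smul c x }

theorem sbarDecompose_mkQ (A : DGAlg K) (a : A) :
    A.sbarDecompose (A.oneLine.mkQ a) = A.sbarDecomposeAux a := rfl

/-- The dg module `s(A / K · 1)`: the class of `a` has degree `deg a - 1`, and the differential
sends it to minus the class of `d a`. -/
def sbar (A : DGAlg K) : DGMod K where
  carrier := A ⧸ A.oneLine
  gr := A.sbarGr
  decomp := DirectSum.Decomposition.ofLinearMap _ A.sbarDecompose
    (Submodule.linearMap_qext _ <| A.hom_ext fun i a ha => by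
      rw [LinearMap.comp_apply, LinearMap.comp_apply, sbarDecompose_mkQ,
        A.sbarDecomposeAux_of_mem (n := i - 1) (by omega) ha]
      simp)
    (by
      refine DirectSum.linearMap_ext _ fun n => LinearMap.ext fun x => ?_
      obtain ⟨_, a, ha, rfl⟩ := x
      simp only [LinearMap.comp_apply, DirectSum.coeLinearMap_lof, LinearMap.id_apply]
      exact (A.sbarDecompose_mkQ a).trans (A.sbarDecomposeAux_of_mem rfl ha))
  d := -A.oneLine.mapQ A.oneLine A.d (by
    rw [Submodule.span_singleton_le_iff_mem]; simp)
  d_mem {n x} hx := by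
    obtain ⟨a, ha, rfl⟩ := hx
    exact Submodule.neg_mem _ (A.mkQ_mem_sbarGr rfl (A.d_mem ha))
  d_d x := by
    obtain ⟨a, rfl⟩ := Submodule.mkQ_surjective _ x
    simp [A.d_d]

/-- The projection `A → s(A / K · 1)`. -/
def bar (A : DGAlg K) : A →ₗ[K] A.sbar := A.oneLine.mkQ

@[simp] theorem bar_one (A : DGAlg K) : A.bar 1 = 0 := by
  exact (Submodule.Quotient.mk_eq_zero _).2 (Submodule.mem_span_singleton_self 1)

theorem bar_surjective (A : DGAlg K) (v : A.sbar) : ∃ a : A, A.bar a = v :=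
  Submodule.mkQ_surjective _ v

theorem d_bar (A : DGAlg K) (a : A) : A.sbar.d (A.bar a) = -A.bar (A.d a) := rfl

theorem bar_mem (A : DGAlg K) {i : ℤ} {a : A} (ha : a ∈ A.gr i) : A.bar a ∈ A.sbar.gr (i - 1) :=
  A.mkQ_mem_sbarGr (by omega) ha

theorem sgn_bar (A : DGAlg K) (n : ℤ) (a : A) :
    A.sbar.sgn n (A.bar a) = koszulSign K n • A.bar (A.sgn n a) := by
  have : A.sbar.sgn n ∘ₗ A.bar = koszulSign K n • (A.bar ∘ₗ A.sgn n) :=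
    A.hom_ext fun i x hx => by
      have h := koszulSign_add K (n * (i - 1)) n
      have h2 : n * (i - 1) + n = n * i := by ring
      rw [h2] at h
      simp only [LinearMap.comp_apply, LinearMap.smul_apply]
      rw [A.sbar.sgn_of_mem n (A.bar_mem hx), A.sgn_of_mem n hx, map_smul, h, smul_smul,
        mul_left_comm, koszulSign_mul_self, mul_one]
  exact LinearMap.congr_fun this a

/-- Linear maps out of `s(A / K · 1)` are linear maps out of `A` that vanish on `1`. -/
def barLift (A : DGAlg K) {N : Type u} [AddCommGroup N] [Module K N] (f : A →ₗ[K] N)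
    (hf : f 1 = 0) : A.sbar →ₗ[K] N :=
  A.oneLine.liftQ f (A.oneLine_le_ker f hf)

@[simp] theorem barLift_bar (A : DGAlg K) {N : Type u} [AddCommGroup N] [Module K N]
    (f : A →ₗ[K] N) (hf : f 1 = 0) (a : A) : A.barLift f hf (A.bar a) = f a := rfl

/-- The map `s(A / K · 1) → s(B / K · 1)` induced by a morphism of dg algebras. -/
def Hom.sbarMap {A B : DGAlg K} (f : Hom A B) : A.sbar →ₗ[K] B.sbar :=
  A.barLift (B.bar ∘ₗ f.toAlgHom.toLinearMap)
    ((congrArg B.bar (map_one f.toAlgHom)).trans B.bar_one)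

@[simp] theorem Hom.sbarMap_bar {A B : DGAlg K} (f : Hom A B) (a : A) :
    f.sbarMap (A.bar a) = B.bar (f.toAlgHom a) := rfl

end DGAlg

/-- A differential graded `A`-`A`-bimodule; `l a m` is `a · m` and `r m a` is `m · a`. -/
structure DGBimod {K : Type u} [CommRing K] (A : DGAlg K) extends DGMod K where
  l : A →ₗ[K] carrier →ₗ[K] carrier
  r : carrier →ₗ[K] A →ₗ[K] carrier
  l_one : ∀ m : carrier, l 1 m = m
  l_mul : ∀ (a b : A) (m : carrier), l (a * b) m = l a (l b m)
  r_one : ∀ m : carrier, r m 1 = m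
  r_mul : ∀ (m : carrier) (a b : A), r m (a * b) = r (r m a) b
  l_r : ∀ (a : A) (m : carrier) (b : A), r (l a m) b = l a (r m b)
  l_mem : ∀ {i j : ℤ} {a : A} {m : carrier}, a ∈ A.gr i → m ∈ gr j → l a m ∈ gr (i + j)
  r_mem : ∀ {i j : ℤ} {m : carrier} {a : A}, m ∈ gr i → a ∈ A.gr j → r m a ∈ gr (i + j)
  d_l : ∀ {i : ℤ} {a : A} (m : carrier), a ∈ A.gr i →
    d (l a m) = l (A.d a) m + koszulSign K i • l a (d m)
  d_r : ∀ {i : ℤ} {m : carrier} (a : A), m ∈ gr i →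
    d (r m a) = r (d m) a + koszulSign K i • r m (A.d a)

namespace DGBimod

variable {K : Type u} [CommRing K] {A B : DGAlg K}

instance : CoeSort (DGBimod A) (Type u) := ⟨fun M => M.carrier⟩

theorem d_l_sgn (M : DGBimod A) (a : A) (m : M) :
    M.d (M.l a m) = M.l (A.d a) m + M.l (A.sgn 1 a) (M.d m) := by
  have : M.l.compr₂ M.d = M.l.comp A.d + M.l.compl₁₂ (A.sgn 1) M.d :=
    A.hom_ext fun i x hx => LinearMap.ext fun y => by
      simp [M.d_l y hx, A.sgn_of_mem 1 hx]
  exact LinearMap.congr_fun (LinearMap.congr_fun this a) m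

theorem d_r_sgn (M : DGBimod A) (m : M) (a : A) :
    M.d (M.r m a) = M.r (M.d m) a + M.r (M.sgn 1 m) (A.d a) := by
  have : M.r.compr₂ M.d = M.r.comp M.d + M.r.compl₁₂ (M.sgn 1) A.d :=
    M.hom_ext fun i x hx => LinearMap.ext fun y => by
      simp [M.d_r y hx, M.sgn_of_mem 1 hx]
  exact LinearMap.congr_fun (LinearMap.congr_fun this m) a

/-- A morphism (of degree zero) of dg bimodules. -/
structure Hom (M N : DGBimod A) where
  toLin : M →ₗ[K] N
  map_mem : ∀ {n : ℤ} {x : M}, x ∈ M.gr n → toLin x ∈ N.gr n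
  map_d : ∀ x : M, toLin (M.d x) = N.d (toLin x)
  map_l : ∀ (a : A) (x : M), toLin (M.l a x) = N.l a (toLin x)
  map_r : ∀ (x : M) (a : A), toLin (M.r x a) = N.r (toLin x) a

/-- The dg algebra `A` as a bimodule over itself. -/
@[reducible] def self (A : DGAlg K) : DGBimod A where
  toDGMod := A.toDGMod
  l := LinearMap.mul K A
  r := LinearMap.mul K A
  l_one := one_mul
  l_mul := mul_assoc
  r_one := mul_one
  r_mul m a b := (mul_assoc m a b).symm
  l_r := mul_assoc
  l_mem := A.mul_mem
  r_mem := A.mul_mem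
  d_l := A.leibniz
  d_r := A.leibniz

/-- Restriction of a dg `B`-`B`-bimodule to a dg `A`-`A`-bimodule along a morphism `A → B`. -/
@[reducible] def restrict (f : DGAlg.Hom A B) (M : DGBimod B) : DGBimod A where
  toDGMod := M.toDGMod
  l := M.l ∘ₗ f.toAlgHom.toLinearMap
  r := M.r.compl₂ f.toAlgHom.toLinearMap
  l_one m := by simp [M.l_one]
  l_mul a b m := by simp [M.l_mul]
  r_one m := by simp [M.r_one]
  r_mul m a b := by simp [M.r_mul]
  l_r a m b := by simp [M.l_r]
  l_mem ha hm := M.l_mem (f.map_mem ha) hm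
  r_mem hm ha := M.r_mem hm (f.map_mem ha)
  d_l m ha := by simpa [f.map_d] using M.d_l m (f.map_mem ha)
  d_r a hm := by simpa [f.map_d] using M.d_r (f.toAlgHom a) hm

/-- The bilinear map `(x, m) ↦ (-1)^(deg a) (class of (a x) ⊗ m - class of a ⊗ x m)`,
for `x` in `A`. -/
def omegaAct₀ (M : DGBimod A) (a : A) : A →ₗ[K] M →ₗ[K] DGMod.tensor A.sbar M.toDGMod :=
  LinearMap.mk₂ K
    (fun x m => DGMod.tmk A.sbar M.toDGMod (A.bar (A.sgn 1 a * x)) m -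
      DGMod.tmk A.sbar M.toDGMod (A.bar (A.sgn 1 a)) (M.l x m))
    (fun x y m => by simp only [mul_add, map_add, LinearMap.add_apply]; abel)
    (fun c x m => by simp only [mul_smul_comm, map_smul, LinearMap.smul_apply, smul_sub])
    (fun x m n => by simp only [map_add]; abel)
    (fun c x m => by simp only [map_smul, smul_sub])

/-- The left action of `A` on `s(A / K · 1) ⊗ M` given by
`a · (class of x ⊗ m) = (-1)^(deg a) (class of (a x) ⊗ m - class of a ⊗ x m)`. -/
def omegaAct (M : DGBimod A) :
    A →ₗ[K] DGMod.tensor A.sbar M.toDGMod →ₗ[K] DGMod.tensor A.sbar M.toDGMod where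
  toFun a := DGMod.tlift (A.barLift (M.omegaAct₀ a) (LinearMap.ext fun m => by
    simp [omegaAct₀, M.l_one]))
  map_add' a b := DGMod.tensor_ext fun v m => by
    obtain ⟨x, rfl⟩ := A.bar_surjective v
    simp only [DGMod.tlift_tmk, DGAlg.barLift_bar, LinearMap.add_apply, omegaAct₀,
      LinearMap.mk₂_apply, map_add, add_mul]
    abel
  map_smul' c a := DGMod.tensor_ext fun v m => by
    obtain ⟨x, rfl⟩ := A.bar_surjective v
    simp only [DGMod.tlift_tmk, DGAlg.barLift_bar, LinearMap.smul_apply, omegaAct₀,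
      LinearMap.mk₂_apply, map_smul, smul_mul_assoc, smul_sub, RingHom.id_apply]

theorem omegaAct_tmk (M : DGBimod A) (a x : A) (m : M) :
    M.omegaAct a (DGMod.tmk A.sbar M.toDGMod (A.bar x) m) =
      DGMod.tmk A.sbar M.toDGMod (A.bar (A.sgn 1 a * x)) m -
        DGMod.tmk A.sbar M.toDGMod (A.bar (A.sgn 1 a)) (M.l x m) := rfl

theorem omega_hom_ext (M : DGBimod A) {N : Type u} [AddCommGroup N] [Module K N]
    {f g : DGMod.tensor A.sbar M.toDGMod →ₗ[K] N}
    (h : ∀ (x : A) (m : M), f (DGMod.tmk A.sbar M.toDGMod (A.bar x) m) =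
      g (DGMod.tmk A.sbar M.toDGMod (A.bar x) m)) : f = g :=
  DGMod.tensor_ext fun v m => by
    obtain ⟨x, rfl⟩ := A.bar_surjective v
    exact h x m

/-- The right action of `A` on `s(A / K · 1) ⊗ M` through the factor `M`. -/
def omegaRight (M : DGBimod A) :
    DGMod.tensor A.sbar M.toDGMod →ₗ[K] A →ₗ[K] DGMod.tensor A.sbar M.toDGMod :=
  DGMod.tlift (LinearMap.mk₂ K (fun v m => DGMod.tmk A.sbar M.toDGMod v ∘ₗ M.r m)
    (fun v w m => by ext a; simp)
    (fun c v m => by ext a; simp)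
    (fun v m n => by ext a; simp)
    (fun c v m => by ext a; simp))

@[simp] theorem omegaRight_tmk (M : DGBimod A) (v : A.sbar) (m : M) (a : A) :
    M.omegaRight (DGMod.tmk A.sbar M.toDGMod v m) a = DGMod.tmk A.sbar M.toDGMod v (M.r m a) := rfl

theorem omega_d_bar (M : DGBimod A) (x : A) (m : M) :
    (DGMod.tensor A.sbar M.toDGMod).d (DGMod.tmk A.sbar M.toDGMod (A.bar x) m) =
      -(DGMod.tmk A.sbar M.toDGMod (A.bar (A.d x)) m) -
        DGMod.tmk A.sbar M.toDGMod (A.bar (A.sgn 1 x)) (M.d m) := by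
  rw [DGMod.d_tmk, A.d_bar, A.sgn_bar, koszulSign_one, neg_one_smul, map_neg, map_neg,
    LinearMap.neg_apply, LinearMap.neg_apply, sub_eq_add_neg]

/-- The dg bimodule `s(A / K · 1) ⊗ M`, with the differential of the tensor product, the right
action on `M`, and the left action
`a · (class of x ⊗ m) = (-1)^(deg a) (class of (a x) ⊗ m - class of a ⊗ x m)`. -/
@[reducible] def omega (M : DGBimod A) : DGBimod A where
  toDGMod := DGMod.tensor A.sbar M.toDGMod
  l := M.omegaAct
  r := M.omegaRight
  l_one z := by
    refine LinearMap.congr_fun (M.omega_hom_ext (g := LinearMap.id) fun x m => ?_) z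
    rw [omegaAct_tmk]; simp
  l_mul a b z := by
    refine LinearMap.congr_fun (M.omega_hom_ext (g := M.omegaAct a ∘ₗ M.omegaAct b)
      fun x m => ?_) z
    rw [LinearMap.comp_apply, omegaAct_tmk, omegaAct_tmk, map_sub, omegaAct_tmk, omegaAct_tmk,
      M.l_mul, A.sgn_mul, mul_assoc]
    abel
  r_one z := by
    refine LinearMap.congr_fun (DGMod.tensor_ext (f := M.omegaRight.flip 1)
      (g := LinearMap.id) fun v m => ?_) z
    simp [M.r_one]
  r_mul z a b := by
    refine LinearMap.congr_fun (DGMod.tensor_ext (f := M.omegaRight.flip (a * b))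
      (g := M.omegaRight.flip b ∘ₗ M.omegaRight.flip a) fun v m => ?_) z
    simp [M.r_mul]
  l_r a z b := by
    refine LinearMap.congr_fun (M.omega_hom_ext (f := M.omegaRight.flip b ∘ₗ M.omegaAct a)
      (g := M.omegaAct a ∘ₗ M.omegaRight.flip b) fun x m => ?_) z
    simp [omegaAct_tmk, M.l_r]
  l_mem {i j a z} ha hz := by
    refine DGMod.tensor_map_mem (M.omegaAct a) _ (fun p q v m h hv hm => ?_) hz
    obtain ⟨x, hx, rfl⟩ := hv
    have hs : A.sgn 1 a ∈ A.gr i := A.toDGMod.sgn_mem 1 ha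
    exact Submodule.sub_mem _
      (DGMod.tmk_mem (i := i + (p + 1) - 1) (j := q) (by omega)
        (A.bar_mem (A.mul_mem hs hx)) hm)
      (DGMod.tmk_mem (i := i - 1) (j := (p + 1) + q) (by omega)
        (A.bar_mem hs) (M.l_mem hx hm))
  r_mem {i j z a} hz ha := by
    refine DGMod.tensor_map_mem (M.omegaRight.flip a) _ (fun p q v m h hv hm => ?_) hz
    exact DGMod.tmk_mem (by omega) hv (M.r_mem hm ha)
  d_l {i a} z ha := by
    refine LinearMap.congr_fun (M.omega_hom_ext
      (f := (DGMod.tensor A.sbar M.toDGMod).d ∘ₗ M.omegaAct a)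
      (g := M.omegaAct (A.d a) + koszulSign K i •
        (M.omegaAct a ∘ₗ (DGMod.tensor A.sbar M.toDGMod).d)) fun x m => ?_) z
    have hs : A.sgn 1 a = koszulSign K i • a := by simpa using A.sgn_of_mem 1 ha
    have hd : A.sgn 1 (A.d a) = -(koszulSign K i • A.d a) := by
      simpa [koszulSign_succ] using A.sgn_of_mem 1 (A.d_mem ha)
    simp only [LinearMap.comp_apply, LinearMap.add_apply, LinearMap.smul_apply, omegaAct_tmk,
      map_sub, map_neg, omega_d_bar, hs, hd, A.d_mul, M.d_l_sgn, A.sgn_mul, map_smul, map_add,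
      smul_mul_assoc, neg_mul, smul_sub, smul_add, smul_neg, smul_smul, LinearMap.neg_apply,
      koszulSign_mul_self, one_smul]
    abel
  d_r {i z} a hz := by
    have hs : (DGMod.tensor A.sbar M.toDGMod).sgn 1 z = koszulSign K i • z := by
      simpa using (DGMod.tensor A.sbar M.toDGMod).sgn_of_mem 1 hz
    rw [← LinearMap.smul_apply, ← map_smul, ← hs]
    clear hs hz
    refine LinearMap.congr_fun (DGMod.tensor_ext
      (f := (DGMod.tensor A.sbar M.toDGMod).d ∘ₗ M.omegaRight.flip a)
      (g := M.omegaRight.flip a ∘ₗ (DGMod.tensor A.sbar M.toDGMod).d +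
        M.omegaRight.flip (A.d a) ∘ₗ (DGMod.tensor A.sbar M.toDGMod).sgn 1)
      fun v m => ?_) z
    simp only [LinearMap.comp_apply, LinearMap.add_apply, LinearMap.flip_apply, omegaRight_tmk,
      DGMod.d_tmk, DGMod.sgn_tmk, map_add, M.d_r_sgn]
    abel

/-- The linear map underlying `omegaMap`. -/
def omegaMapLin (f : DGAlg.Hom A B) {M : DGBimod A} {N : DGBimod B} (φ : M →ₗ[K] N) :
    DGMod.tensor A.sbar M.toDGMod →ₗ[K] DGMod.tensor B.sbar N.toDGMod :=
  DGMod.tlift ((DGMod.tmk B.sbar N.toDGMod).compl₁₂ f.sbarMap φ)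

@[simp] theorem omegaMapLin_tmk (f : DGAlg.Hom A B) {M : DGBimod A} {N : DGBimod B}
    (φ : M →ₗ[K] N) (v : A.sbar) (m : M) :
    omegaMapLin f φ (DGMod.tmk A.sbar M.toDGMod v m) =
      DGMod.tmk B.sbar N.toDGMod (f.sbarMap v) (φ m) := rfl

/-- The map `s(A / K · 1) ⊗ M → s(B / K · 1) ⊗ N` induced by a morphism of dg algebras `A → B` and
a morphism `M → N` of bimodules over it. -/
def omegaMap (f : DGAlg.Hom A B) {M : DGBimod A} {N : DGBimod B}
    (φ : Hom M (restrict f N)) : Hom (omega M) (restrict f (omega N)) where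
  toLin := omegaMapLin f φ.toLin
  map_mem {n z} hz := by
    refine DGMod.tensor_map_mem _ _ (fun p q v m h hv hm => ?_) hz
    obtain ⟨x, hx, rfl⟩ := hv
    have hv : f.sbarMap (A.bar x) ∈ B.sbar.gr p := ⟨f.toAlgHom x, f.map_mem hx, rfl⟩
    exact DGMod.tmk_mem h hv (φ.map_mem hm)
  map_d z := by
    refine LinearMap.congr_fun (M.omega_hom_ext
      (f := omegaMapLin f φ.toLin ∘ₗ (DGMod.tensor A.sbar M.toDGMod).d)
      (g := (DGMod.tensor B.sbar N.toDGMod).d ∘ₗ omegaMapLin f φ.toLin)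
      fun x m => ?_) z
    simp only [LinearMap.comp_apply, omega_d_bar, map_sub, map_neg, omegaMapLin_tmk,
      DGAlg.Hom.sbarMap_bar, f.map_sgn, f.map_d, φ.map_d]
  map_l a z := by
    refine LinearMap.congr_fun (M.omega_hom_ext
      (f := omegaMapLin f φ.toLin ∘ₗ M.omegaAct a)
      (g := N.omegaAct (f.toAlgHom a) ∘ₗ omegaMapLin f φ.toLin)
      fun x m => ?_) z
    simp only [LinearMap.comp_apply, omegaAct_tmk, map_sub, omegaMapLin_tmk,
      DGAlg.Hom.sbarMap_bar, f.map_sgn, map_mul, φ.map_l]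
    rfl
  map_r z a := by
    refine LinearMap.congr_fun (DGMod.tensor_ext
      (f := omegaMapLin f φ.toLin ∘ₗ M.omegaRight.flip a)
      (g := N.omegaRight.flip (f.toAlgHom a) ∘ₗ omegaMapLin f φ.toLin)
      fun v m => ?_) z
    simp only [LinearMap.comp_apply, LinearMap.flip_apply, omegaRight_tmk, omegaMapLin_tmk,
      φ.map_r]
    rfl

end DGBimod

namespace DGAlg

variable {K : Type u} [CommRing K]

/-- The tensor powers `s(A / K · 1)^{⊗ m}`. -/
def bars (A : DGAlg K) : ℕ → DGMod K
  | 0 => DGMod.unit K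
  | m + 1 => DGMod.tensor A.sbar (A.bars m)

/-- The dg bimodule `Ω^p(A) = s(A / K · 1)^{⊗ p} ⊗ A` of noncommutative differential `p`-forms.
Unwinding the recursion, the right action is by multiplication on the last factor, and
`a · (x₁ ⊗ ⋯ ⊗ x_p ⊗ x_{p+1})` is the image of `b (a ⊗ x₁ ⊗ ⋯ ⊗ x_p ⊗ x_{p+1})` under the
projection `A ⊗ s(A / K · 1)^{⊗ (p - 1)} ⊗ A → s(A / K · 1)^{⊗ p} ⊗ A`, where `b` is the
differential of the bar resolution with the Koszul signs. -/
def Omega (A : DGAlg K) : ℕ → DGBimod A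
  | 0 => DGBimod.self A
  | p + 1 => DGBimod.omega (A.Omega p)

/-- The element `1` of `s(A / K · 1)^{⊗ 0} = K`. -/
def bone (A : DGAlg K) : A.bars 0 := (1 : K)

/-- The map `(v, t) ↦ v ⊗ t`. -/
def bcons (A : DGAlg K) (m : ℕ) : A.sbar →ₗ[K] A.bars m →ₗ[K] A.bars (m + 1) :=
  DGMod.tmk A.sbar (A.bars m)

/-- The linear map out of `s(A / K · 1)^{⊗ (m + 1)}` given by a bilinear map. -/
def blift (A : DGAlg K) {m : ℕ} {N : Type u} [AddCommGroup N] [Module K N]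
    (f : A.sbar →ₗ[K] A.bars m →ₗ[K] N) : A.bars (m + 1) →ₗ[K] N := DGMod.tlift f

/-- The identification of `A` with `Ω^0(A)`. -/
def ozero (A : DGAlg K) : A →ₗ[K] A.Omega 0 := LinearMap.id (R := K) (M := A)

/-- The map `(v, w) ↦ v ⊗ w`. -/
def ocons (A : DGAlg K) (m : ℕ) : A.sbar →ₗ[K] A.Omega m →ₗ[K] A.Omega (m + 1) :=
  DGMod.tmk A.sbar (A.Omega m).toDGMod

/-- The linear map out of `Ω^{m + 1}(A)` given by a bilinear map. -/
def olift (A : DGAlg K) {m : ℕ} {N : Type u} [AddCommGroup N] [Module K N]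
    (f : A.sbar →ₗ[K] A.Omega m →ₗ[K] N) : A.Omega (m + 1) →ₗ[K] N := DGMod.tlift f

section

variable (A : DGAlg K) {m : ℕ} {N : Type u} [AddCommGroup N] [Module K N]

@[simp] theorem blift_bcons (f : A.sbar →ₗ[K] A.bars m →ₗ[K] N) (v : A.sbar) (t : A.bars m) :
    A.blift f (A.bcons m v t) = f v t := rfl

@[simp] theorem olift_ocons (f : A.sbar →ₗ[K] A.Omega m →ₗ[K] N) (v : A.sbar) (w : A.Omega m) :
    A.olift f (A.ocons m v w) = f v w := rfl

theorem bars_zero_ext {f g : A.bars 0 →ₗ[K] N} (h : f A.bone = g A.bone) : f = g :=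
  LinearMap.ext_ring (R := K) (f := f) (g := g) h

theorem bars_ext {f g : A.bars (m + 1) →ₗ[K] N}
    (h : ∀ (x : A) (t : A.bars m), f (A.bcons m (A.bar x) t) = g (A.bcons m (A.bar x) t)) :
    f = g :=
  DGMod.tensor_ext fun v t => by
    obtain ⟨x, rfl⟩ := A.bar_surjective v
    exact h x t

theorem Omega_zero_ext {f g : A.Omega 0 →ₗ[K] N} (h : ∀ a, f (A.ozero a) = g (A.ozero a)) :
    f = g := LinearMap.ext h

theorem Omega_ext {f g : A.Omega (m + 1) →ₗ[K] N}
    (h : ∀ (x : A) (w : A.Omega m), f (A.ocons m (A.bar x) w) = g (A.ocons m (A.bar x) w)) :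
    f = g :=
  DGMod.tensor_ext fun v w => by
    obtain ⟨x, rfl⟩ := A.bar_surjective v
    exact h x w

theorem bone_mem : A.bone ∈ (A.bars 0).gr 0 := by
  change (1 : K) ∈ (if (0 : ℤ) = 0 then ⊤ else ⊥ : Submodule K K)
  simp

theorem bars_zero_map_mem (f : A.bars 0 →ₗ[K] N) {i : ℤ} (S : Submodule K N)
    (h : i = 0 → f A.bone ∈ S) {t : A.bars 0} (ht : t ∈ (A.bars 0).gr i) : f t ∈ S := by
  by_cases hi : i = 0
  · have h1 : ∀ c : K, f (c : K) ∈ S := fun c => by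
      have h2 : (c : A.bars 0) = (c • A.bone : A.bars 0) := (mul_one c).symm
      rw [h2, map_smul]
      exact Submodule.smul_mem _ _ (h hi)
    exact h1 t
  · have h1 : (A.bars 0).gr i = ⊥ := if_neg hi
    rw [h1] at ht
    obtain rfl := (Submodule.mem_bot K).1 ht
    rw [map_zero]
    exact Submodule.zero_mem _

theorem bcons_mem {i j n : ℤ} (h : i + j = n) {v : A.sbar} (hv : v ∈ A.sbar.gr i) {t : A.bars m}
    (ht : t ∈ (A.bars m).gr j) : A.bcons m v t ∈ (A.bars (m + 1)).gr n :=
  DGMod.tmk_mem h hv ht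

theorem bars_map_mem (f : A.bars (m + 1) →ₗ[K] N) {n : ℤ} (S : Submodule K N)
    (h : ∀ (i j : ℤ) (v : A.sbar) (t : A.bars m), i + j = n → v ∈ A.sbar.gr i →
      t ∈ (A.bars m).gr j → f (A.bcons m v t) ∈ S)
    {z : A.bars (m + 1)} (hz : z ∈ (A.bars (m + 1)).gr n) : f z ∈ S :=
  DGMod.tensor_map_mem f S h hz

theorem ozero_mem {i : ℤ} {a : A} (ha : a ∈ A.gr i) : A.ozero a ∈ (A.Omega 0).gr i := ha

theorem Omega_zero_map_mem (f : A.Omega 0 →ₗ[K] N) {i : ℤ} (S : Submodule K N)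
    (h : ∀ a ∈ A.gr i, f (A.ozero a) ∈ S) {w : A.Omega 0} (hw : w ∈ (A.Omega 0).gr i) :
    f w ∈ S := h w hw

theorem ocons_mem {i j n : ℤ} (h : i + j = n) {v : A.sbar} (hv : v ∈ A.sbar.gr i) {w : A.Omega m}
    (hw : w ∈ (A.Omega m).gr j) : A.ocons m v w ∈ (A.Omega (m + 1)).gr n :=
  DGMod.tmk_mem h hv hw

theorem Omega_map_mem (f : A.Omega (m + 1) →ₗ[K] N) {n : ℤ} (S : Submodule K N)
    (h : ∀ (i j : ℤ) (v : A.sbar) (w : A.Omega m), i + j = n → v ∈ A.sbar.gr i →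
      w ∈ (A.Omega m).gr j → f (A.ocons m v w) ∈ S)
    {z : A.Omega (m + 1)} (hz : z ∈ (A.Omega (m + 1)).gr n) : f z ∈ S :=
  DGMod.tensor_map_mem f S h hz

@[simp] theorem d_bone : (A.bars 0).d A.bone = 0 := rfl

theorem d_bcons (x : A) (t : A.bars m) :
    (A.bars (m + 1)).d (A.bcons m (A.bar x) t) =
      -A.bcons m (A.bar (A.d x)) t - A.bcons m (A.bar (A.sgn 1 x)) ((A.bars m).d t) := by
  have h : (A.bars (m + 1)).d (A.bcons m (A.bar x) t) =
      A.bcons m (A.sbar.d (A.bar x)) t + A.bcons m (A.sbar.sgn 1 (A.bar x)) ((A.bars m).d t) :=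
    DGMod.d_tmk _ _ _ _
  rw [h, A.d_bar, A.sgn_bar, koszulSign_one, neg_one_smul, map_neg, map_neg,
    LinearMap.neg_apply, LinearMap.neg_apply, sub_eq_add_neg]

@[simp] theorem d_ozero (a : A) : (A.Omega 0).d (A.ozero a) = A.ozero (A.d a) := rfl

theorem d_ocons (x : A) (w : A.Omega m) :
    (A.Omega (m + 1)).d (A.ocons m (A.bar x) w) =
      -A.ocons m (A.bar (A.d x)) w - A.ocons m (A.bar (A.sgn 1 x)) ((A.Omega m).d w) :=
  (A.Omega m).omega_d_bar x w

@[simp] theorem l_ozero (a b : A) : (A.Omega 0).l a (A.ozero b) = A.ozero (a * b) := rfl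

@[simp] theorem r_ozero (a b : A) : (A.Omega 0).r (A.ozero a) b = A.ozero (a * b) := rfl

theorem l_ocons (a x : A) (w : A.Omega m) :
    (A.Omega (m + 1)).l a (A.ocons m (A.bar x) w) =
      A.ocons m (A.bar (A.sgn 1 a * x)) w - A.ocons m (A.bar (A.sgn 1 a)) ((A.Omega m).l x w) :=
  rfl

@[simp] theorem r_ocons (v : A.sbar) (w : A.Omega m) (a : A) :
    (A.Omega (m + 1)).r (A.ocons m v w) a = A.ocons m v ((A.Omega m).r w a) := rfl

end

/-- The map `s(A / K · 1)^{⊗ m} → s(A / K · 1)^{⊗ m} ⊗ A` sending `t` to `t ⊗ 1`. -/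
def barsIncl (A : DGAlg K) : ∀ m : ℕ, A.bars m →ₗ[K] A.Omega m
  | 0 => Algebra.linearMap K A
  | m + 1 => A.blift ((A.ocons m).compl₂ (A.barsIncl m))

@[simp] theorem barsIncl_bone (A : DGAlg K) : A.barsIncl 0 A.bone = A.ozero 1 :=
  map_one (algebraMap K A)

@[simp] theorem barsIncl_bcons (A : DGAlg K) (m : ℕ) (v : A.sbar) (t : A.bars m) :
    A.barsIncl (m + 1) (A.bcons m v t) = A.ocons m v (A.barsIncl m t) := rfl

theorem barsIncl_mem (A : DGAlg K) : ∀ (m : ℕ) {i : ℤ} {t : A.bars m},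
    t ∈ (A.bars m).gr i → A.barsIncl m t ∈ (A.Omega m).gr i
  | 0, i, t, ht => A.bars_zero_map_mem (A.barsIncl 0) _ (fun h => by
      subst h; rw [barsIncl_bone]; exact A.ozero_mem A.one_mem) ht
  | m + 1, i, t, ht =>
    A.bars_map_mem (A.barsIncl (m + 1)) _
      (fun _ _ _ _ h hv hs => A.ocons_mem h hv (A.barsIncl_mem m hs)) ht

theorem barsIncl_d (A : DGAlg K) : ∀ (m : ℕ) (t : A.bars m),
    A.barsIncl m ((A.bars m).d t) = (A.Omega m).d (A.barsIncl m t)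
  | 0, t => by
    refine LinearMap.congr_fun (A.bars_zero_ext (f := A.barsIncl 0 ∘ₗ (A.bars 0).d)
      (g := (A.Omega 0).d ∘ₗ A.barsIncl 0) ?_) t
    simp
  | m + 1, t => by
    refine LinearMap.congr_fun (A.bars_ext
      (f := A.barsIncl (m + 1) ∘ₗ (A.bars (m + 1)).d)
      (g := (A.Omega (m + 1)).d ∘ₗ A.barsIncl (m + 1)) fun v t => ?_) t
    simp [d_bcons, d_ocons, A.barsIncl_d m]

/-- The map `s(A / K · 1)^{⊗ m} → s(B / K · 1)^{⊗ m}` induced by a morphism of dg algebras. -/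
def Hom.barsMap {A B : DGAlg K} (f : Hom A B) : ∀ m : ℕ, A.bars m →ₗ[K] B.bars m
  | 0 => LinearMap.id (R := K) (M := K)
  | m + 1 => A.blift ((B.bcons m).compl₁₂ f.sbarMap (f.barsMap m))

/-- The map `Ω^p(A) → Ω^p(B)` induced by a morphism of dg algebras, which sends
`a₁ ⊗ ⋯ ⊗ a_{p+1}` to `f(a₁) ⊗ ⋯ ⊗ f(a_{p+1})`, as a morphism of `A`-`A`-bimodules. -/
def Hom.omegaMap {A B : DGAlg K} (f : Hom A B) :
    ∀ p : ℕ, DGBimod.Hom (A.Omega p) (DGBimod.restrict f (B.Omega p))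
  | 0 =>
    { toLin := f.toAlgHom.toLinearMap
      map_mem := f.map_mem
      map_d := f.map_d
      map_l := map_mul f.toAlgHom
      map_r := map_mul f.toAlgHom }
  | p + 1 => DGBimod.omegaMap f (f.omegaMap p)

section

variable {A B : DGAlg K} (f : Hom A B)

@[simp] theorem Hom.barsMap_bone : f.barsMap 0 A.bone = B.bone := rfl

@[simp] theorem Hom.barsMap_bcons (m : ℕ) (v : A.sbar) (t : A.bars m) :
    f.barsMap (m + 1) (A.bcons m v t) = B.bcons m (f.sbarMap v) (f.barsMap m t) := rfl

@[simp] theorem Hom.omegaMap_ozero (a : A) :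
    (f.omegaMap 0).toLin (A.ozero a) = B.ozero (f.toAlgHom a) := rfl

@[simp] theorem Hom.omegaMap_ocons (m : ℕ) (v : A.sbar) (w : A.Omega m) :
    (f.omegaMap (m + 1)).toLin (A.ocons m v w) =
      B.ocons m (f.sbarMap v) ((f.omegaMap m).toLin w) := rfl

theorem Hom.sbarMap_mem {i : ℤ} {v : A.sbar} (hv : v ∈ A.sbar.gr i) :
    f.sbarMap v ∈ B.sbar.gr i := by
  obtain ⟨x, hx, rfl⟩ := hv
  exact ⟨f.toAlgHom x, f.map_mem hx, rfl⟩

theorem Hom.barsMap_mem : ∀ (m : ℕ) {i : ℤ} {t : A.bars m},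
    t ∈ (A.bars m).gr i → f.barsMap m t ∈ (B.bars m).gr i
  | 0, _, _, ht => ht
  | m + 1, _, _, ht =>
    A.bars_map_mem (f.barsMap (m + 1)) _
      (fun _ _ _ _ h hv hs => B.bcons_mem h (f.sbarMap_mem hv) (Hom.barsMap_mem m hs)) ht

theorem Hom.barsMap_d : ∀ (m : ℕ) (t : A.bars m),
    f.barsMap m ((A.bars m).d t) = (B.bars m).d (f.barsMap m t)
  | 0, _ => rfl
  | m + 1, t => by
    refine LinearMap.congr_fun (A.bars_ext
      (f := f.barsMap (m + 1) ∘ₗ (A.bars (m + 1)).d)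
      (g := (B.bars (m + 1)).d ∘ₗ f.barsMap (m + 1)) fun x t => ?_) t
    simp [d_bcons, Hom.barsMap_d m, f.map_d, f.map_sgn]

theorem Hom.omegaMap_incl : ∀ (m : ℕ) (t : A.bars m),
    (f.omegaMap m).toLin (A.barsIncl m t) = B.barsIncl m (f.barsMap m t)
  | 0, t => by
    refine LinearMap.congr_fun (A.bars_zero_ext
      (f := (f.omegaMap 0).toLin ∘ₗ A.barsIncl 0) (g := B.barsIncl 0 ∘ₗ f.barsMap 0) ?_) t
    rw [LinearMap.comp_apply, barsIncl_bone, omegaMap_ozero, map_one]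
    exact B.barsIncl_bone.symm
  | m + 1, t => by
    refine LinearMap.congr_fun (A.bars_ext
      (f := (f.omegaMap (m + 1)).toLin ∘ₗ A.barsIncl (m + 1))
      (g := B.barsIncl (m + 1) ∘ₗ f.barsMap (m + 1)) fun x t => ?_) t
    exact congrArg (B.ocons m (f.sbarMap (A.bar x))) (Hom.omegaMap_incl m t)

end

end DGAlg

namespace DGBimod

variable {K : Type u} [CommRing K] {A B : DGAlg K}

/-- The extension of a linear map `f : s(A / K · 1)^{⊗ m} → M` to the map
`s(A / K · 1)^{⊗ m} ⊗ A → M` of right `A`-modules that sends `t ⊗ a` to `f(t) · a`. -/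
def extend (M : DGBimod A) : ∀ m : ℕ, (A.bars m →ₗ[K] M) →ₗ[K] (A.Omega m →ₗ[K] M)
  | 0 => M.r ∘ₗ LinearMap.applyₗ A.bone
  | m + 1 =>
    { toFun := fun f => A.olift (M.extend m ∘ₗ (A.bcons m).compr₂ f)
      map_add' := fun f g => A.Omega_ext fun x w => by
        change M.extend m ((f + g) ∘ₗ A.bcons m (A.bar x)) w =
          (M.extend m (f ∘ₗ A.bcons m (A.bar x)) + M.extend m (g ∘ₗ A.bcons m (A.bar x))) w
        rw [LinearMap.add_comp, map_add]
      map_smul' := fun c f => A.Omega_ext fun x w => by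
        change M.extend m ((c • f) ∘ₗ A.bcons m (A.bar x)) w =
          (c • M.extend m (f ∘ₗ A.bcons m (A.bar x))) w
        rw [LinearMap.smul_comp, map_smul] }

@[simp] theorem extend_ozero (M : DGBimod A) (f : A.bars 0 →ₗ[K] M) (a : A) :
    M.extend 0 f (A.ozero a) = M.r (f A.bone) a := rfl

theorem extend_ocons (M : DGBimod A) (m : ℕ) (f : A.bars (m + 1) →ₗ[K] M) (v : A.sbar)
    (w : A.Omega m) : M.extend (m + 1) f (A.ocons m v w) = M.extend m (f ∘ₗ A.bcons m v) w := rfl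

theorem extend_r (M : DGBimod A) : ∀ (m : ℕ) (f : A.bars m →ₗ[K] M) (w : A.Omega m) (a : A),
    M.extend m f ((A.Omega m).r w a) = M.r (M.extend m f w) a
  | 0, f, w, a => M.r_mul _ _ _
  | m + 1, f, w, a => by
    refine LinearMap.congr_fun (A.Omega_ext
      (f := M.extend (m + 1) f ∘ₗ (A.Omega (m + 1)).r.flip a)
      (g := M.r.flip a ∘ₗ M.extend (m + 1) f) fun v w => ?_) w
    exact M.extend_r m _ w a

theorem extend_uniq (M : DGBimod A) : ∀ (m : ℕ) (f : A.bars m →ₗ[K] M) (G : A.Omega m →ₗ[K] M)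
    (_ : ∀ w a, G ((A.Omega m).r w a) = M.r (G w) a) (_ : ∀ t, G (A.barsIncl m t) = f t),
    M.extend m f = G
  | 0, f, G, hr, hi => A.Omega_zero_ext fun a => by
    rw [extend_ozero, ← hi, ← hr, DGAlg.barsIncl_bone, DGAlg.r_ozero, one_mul]
  | m + 1, f, G, hr, hi => A.Omega_ext fun x w => by
    refine LinearMap.congr_fun (M.extend_uniq m (f ∘ₗ A.bcons m (A.bar x))
      (G ∘ₗ A.ocons m (A.bar x)) (fun w a => ?_) (fun t => ?_)) w
    · exact hr (A.ocons m (A.bar x) w) a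
    · exact hi (A.bcons m (A.bar x) t)

theorem extend_incl (M : DGBimod A) : ∀ (m : ℕ) (f : A.bars m →ₗ[K] M) (t : A.bars m),
    M.extend m f (A.barsIncl m t) = f t
  | 0, f, t => by
    refine LinearMap.congr_fun (A.bars_zero_ext
      (f := M.extend 0 f ∘ₗ A.barsIncl 0) (g := f) ?_) t
    simp [M.r_one]
  | m + 1, f, t => by
    refine LinearMap.congr_fun (A.bars_ext
      (f := M.extend (m + 1) f ∘ₗ A.barsIncl (m + 1)) (g := f) fun v t => ?_) t
    exact M.extend_incl m _ t

/-- The linear maps `s(A / K · 1)^{⊗ m} → M` of degree `n`. -/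
def IsHomog (M : DGBimod A) (m : ℕ) (n : ℤ) (f : A.bars m →ₗ[K] M) : Prop :=
  ∀ ⦃j : ℤ⦄ ⦃t : A.bars m⦄, t ∈ (A.bars m).gr j → f t ∈ M.gr (j + n)

theorem extend_mem (M : DGBimod A) : ∀ (m : ℕ) (n : ℤ) (f : A.bars m →ₗ[K] M)
    (_ : M.IsHomog m n f) {j : ℤ} {w : A.Omega m}, w ∈ (A.Omega m).gr j →
    M.extend m f w ∈ M.gr (j + n)
  | 0, n, f, hf, j, w, hw =>
    A.Omega_zero_map_mem (M.extend 0 f) (M.gr (j + n)) (fun a ha => by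
      have h2 := M.r_mem (hf A.bone_mem) ha
      rwa [zero_add, add_comm] at h2) hw
  | m + 1, n, f, hf, j, w, hw =>
    A.Omega_map_mem (M.extend (m + 1) f) (M.gr (j + n)) (fun p q v w h hv hw => by
      have h3 := M.extend_mem m (p + n) (f ∘ₗ A.bcons m v)
        (fun i t ht => by
          have h4 := hf (A.bcons_mem rfl hv ht)
          rwa [show p + i + n = i + (p + n) by ring] at h4) hw
      rwa [show q + (p + n) = j + n by omega] at h3) hw

/-- The vertical differential on maps `f` of degree `n`,
`δᵛ f = d ∘ f - (-1)^n f ∘ d`. -/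
def deltaV (M : DGBimod A) (m : ℕ) (n : ℤ) : (A.bars m →ₗ[K] M) →ₗ[K] (A.bars m →ₗ[K] M) where
  toFun f := M.d ∘ₗ f - koszulSign K n • (f ∘ₗ (A.bars m).d)
  map_add' f g := by ext; simp; abel
  map_smul' c f := by ext; simp [smul_sub, smul_smul, mul_comm]

/-- The bilinear map underlying the horizontal differential, on lifts to `A`. -/
def deltaHAux (M : DGBimod A) (m : ℕ) (n : ℤ) (f : A.bars m →ₗ[K] M) :
    A →ₗ[K] A.bars m →ₗ[K] M :=
  LinearMap.mk₂ K
    (fun (a : A) (t : A.bars m) => -koszulSign K n •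
      (M.l (A.sgn n a) (f t) - M.extend m f ((A.Omega m).l a (A.barsIncl m t))))
    (fun a b t => by simp only [map_add, LinearMap.add_apply, ← smul_add]; congr 1; abel)
    (fun c a t => by
      simp only [map_smul, LinearMap.smul_apply, ← smul_sub]; rw [smul_comm])
    (fun a t s => by simp only [map_add, ← smul_add]; congr 1; abel)
    (fun c a t => by simp only [map_smul, ← smul_sub]; rw [smul_comm])

theorem deltaHAux_apply (M : DGBimod A) (m : ℕ) (n : ℤ) (f : A.bars m →ₗ[K] M) (a : A)
    (t : A.bars m) : M.deltaHAux m n f a t = -koszulSign K n •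
      (M.l (A.sgn n a) (f t) - M.extend m f ((A.Omega m).l a (A.barsIncl m t))) := rfl

theorem deltaHAux_one (M : DGBimod A) (m : ℕ) (n : ℤ) (f : A.bars m →ₗ[K] M) :
    M.deltaHAux m n f 1 = 0 := LinearMap.ext fun t => by
  rw [deltaHAux_apply, A.sgn_one, M.l_one, (A.Omega m).l_one, extend_incl, sub_self, smul_zero,
    LinearMap.zero_apply]

/-- The horizontal differential on maps `f` of degree `n`, induced by the bar resolution:
`(δʰ f)(a ⊗ t) = -(-1)^n ((-1)^(n * deg a) a · f(t) - f'(a · (t ⊗ 1)))`, where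
`f'(t ⊗ a) = f(t) · a` and `a · (t ⊗ 1)` is the left action on `Ω^m(A)`. -/
def deltaH (M : DGBimod A) (m : ℕ) (n : ℤ) :
    (A.bars m →ₗ[K] M) →ₗ[K] (A.bars (m + 1) →ₗ[K] M) where
  toFun f := A.blift (A.barLift (M.deltaHAux m n f) (M.deltaHAux_one m n f))
  map_add' f g := A.bars_ext fun x t => by
    rw [LinearMap.add_apply, DGAlg.blift_bcons, DGAlg.blift_bcons, DGAlg.blift_bcons,
      DGAlg.barLift_bar, DGAlg.barLift_bar, DGAlg.barLift_bar, deltaHAux_apply, deltaHAux_apply,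
      deltaHAux_apply, ← smul_add, map_add, LinearMap.add_apply, LinearMap.add_apply, map_add]
    congr 1
    abel
  map_smul' c f := A.bars_ext fun x t => by
    rw [LinearMap.smul_apply, DGAlg.blift_bcons, DGAlg.blift_bcons, DGAlg.barLift_bar,
      DGAlg.barLift_bar, deltaHAux_apply, deltaHAux_apply, RingHom.id_apply, smul_comm c, map_smul,
      LinearMap.smul_apply, LinearMap.smul_apply, map_smul, ← smul_sub]

theorem deltaV_apply (M : DGBimod A) (m : ℕ) (n : ℤ) (f : A.bars m →ₗ[K] M) (t : A.bars m) :
    M.deltaV m n f t = M.d (f t) - koszulSign K n • f ((A.bars m).d t) := rfl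

theorem deltaH_bcons (M : DGBimod A) (m : ℕ) (n : ℤ) (f : A.bars m →ₗ[K] M) (x : A)
    (t : A.bars m) :
    M.deltaH m n f (A.bcons m (A.bar x) t) = -koszulSign K n •
      (M.l (A.sgn n x) (f t) - M.extend m f ((A.Omega m).l x (A.barsIncl m t))) := rfl

theorem sgn_extend (M : DGBimod A) {m : ℕ} {n : ℤ} {f : A.bars m →ₗ[K] M}
    (hf : M.IsHomog m n f) (w : A.Omega m) :
    M.sgn 1 (M.extend m f w) = koszulSign K n • M.extend m f ((A.Omega m).sgn 1 w) := by
  have : M.sgn 1 ∘ₗ M.extend m f = koszulSign K n • (M.extend m f ∘ₗ (A.Omega m).sgn 1) :=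
    (A.Omega m).hom_ext fun i x hx => by
      simp only [LinearMap.comp_apply, LinearMap.smul_apply]
      rw [M.sgn_of_mem 1 (M.extend_mem m n f hf hx), (A.Omega m).sgn_of_mem 1 hx, map_smul,
        smul_smul, one_mul, one_mul, koszulSign_add, mul_comm]
  exact LinearMap.congr_fun this w

theorem extend_deltaV (M : DGBimod A) (m : ℕ) (n : ℤ) (f : A.bars m →ₗ[K] M)
    (hf : M.IsHomog m n f) (w : A.Omega m) :
    M.extend m (M.deltaV m n f) w =
      M.d (M.extend m f w) - koszulSign K n • M.extend m f ((A.Omega m).d w) := by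
  refine LinearMap.congr_fun (M.extend_uniq m (M.deltaV m n f)
    (M.d ∘ₗ M.extend m f - koszulSign K n • (M.extend m f ∘ₗ (A.Omega m).d))
    (fun w a => ?_) (fun t => ?_)) w
  · simp only [LinearMap.comp_apply, LinearMap.smul_apply, LinearMap.sub_apply, extend_r, d_r_sgn,
      map_add, map_sub, map_smul, smul_add, sgn_extend M hf]
    abel
  · simp only [LinearMap.comp_apply, LinearMap.smul_apply, LinearMap.sub_apply, extend_incl,
      ← DGAlg.barsIncl_d, deltaV_apply]

theorem extend_deltaH (M : DGBimod A) (m : ℕ) (n : ℤ) (f : A.bars m →ₗ[K] M)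
    (x : A) (w : A.Omega m) :
    M.extend (m + 1) (M.deltaH m n f) (A.ocons m (A.bar x) w) = -koszulSign K n •
      (M.l (A.sgn n x) (M.extend m f w) - M.extend m f ((A.Omega m).l x w)) := by
  rw [extend_ocons]
  refine LinearMap.congr_fun (M.extend_uniq m _
    (-koszulSign K n • (M.l (A.sgn n x) ∘ₗ M.extend m f - M.extend m f ∘ₗ (A.Omega m).l x))
    (fun w a => ?_) (fun t => ?_)) w
  · simp only [LinearMap.comp_apply, LinearMap.smul_apply, LinearMap.sub_apply, extend_r,
      ← (A.Omega m).l_r, ← M.l_r, map_smul, map_sub]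
  · simp only [LinearMap.comp_apply, LinearMap.smul_apply, LinearMap.sub_apply, extend_incl,
      deltaH_bcons]

theorem deltaV_deltaV (M : DGBimod A) (m : ℕ) (n : ℤ) (f : A.bars m →ₗ[K] M) :
    M.deltaV m (n + 1) (M.deltaV m n f) = 0 := LinearMap.ext fun t => by
  simp only [deltaV_apply, map_sub, map_smul, M.d_d, (A.bars m).d_d, koszulSign_succ,
    LinearMap.zero_apply, map_zero]
  simp

theorem deltaH_deltaH (M : DGBimod A) (m : ℕ) (n : ℤ) (f : A.bars m →ₗ[K] M) :
    M.deltaH (m + 1) (n + 1) (M.deltaH m n f) = 0 :=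
  A.bars_ext fun x z => by
    refine LinearMap.congr_fun (A.bars_ext
      (f := M.deltaH (m + 1) (n + 1) (M.deltaH m n f) ∘ₗ A.bcons (m + 1) (A.bar x)) (g := 0)
      fun y t => ?_) z
    rw [LinearMap.comp_apply, deltaH_bcons, deltaH_bcons, DGAlg.barsIncl_bcons, DGAlg.l_ocons,
      map_sub, extend_deltaH, extend_deltaH, A.sgn_mul, (A.Omega m).l_mul]
    have h : A.sgn n (A.sgn 1 x) = A.sgn (n + 1) x := (A.toDGMod.sgn_succ n x).symm
    rw [h, M.l_mul, map_smul, map_sub, LinearMap.zero_apply, extend_incl]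
    module

theorem deltaV_deltaH (M : DGBimod A) (m : ℕ) (n : ℤ) (f : A.bars m →ₗ[K] M)
    (hf : M.IsHomog m n f) :
    M.deltaV (m + 1) (n + 1) (M.deltaH m n f) + M.deltaH m (n + 1) (M.deltaV m n f) = 0 :=
  A.bars_ext fun x t => by
    have h : A.sgn n (A.sgn 1 x) = A.sgn (n + 1) x := (A.toDGMod.sgn_succ n x).symm
    have h2 : A.sgn 1 (A.sgn n x) = A.sgn (n + 1) x := (A.toDGMod.sgn_comm n x).trans h
    have h3 : A.sgn n (A.d x) = koszulSign K n • A.d (A.sgn n x) := A.toDGMod.sgn_d n x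
    rw [LinearMap.add_apply, deltaV_apply, deltaH_bcons, deltaH_bcons, DGAlg.d_bcons, map_sub,
      map_neg, deltaH_bcons, deltaH_bcons, extend_deltaV M m n f hf, deltaV_apply, map_smul,
      map_sub, M.d_l_sgn, (A.Omega m).d_l_sgn, ← A.barsIncl_d, h, h2, h3]
    simp only [koszulSign_succ, map_smul, map_sub, map_add, LinearMap.smul_apply, smul_sub,
      smul_add, neg_smul, smul_neg, smul_smul, neg_mul, koszulSign_mul_self,
      neg_neg, one_smul, LinearMap.zero_apply]
    abel

end DGBimod

namespace DGBimod

variable {K : Type u} [CommRing K] {A B : DGAlg K}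

theorem IsHomog.deltaV {M : DGBimod A} {m : ℕ} {n : ℤ} {f : A.bars m →ₗ[K] M}
    (hf : M.IsHomog m n f) : M.IsHomog m (n + 1) (M.deltaV m n f) := fun j t ht => by
  have h1 := M.d_mem (hf ht)
  have h2 := hf ((A.bars m).d_mem ht)
  rw [add_assoc] at h1
  rw [add_right_comm, add_assoc] at h2
  exact Submodule.sub_mem _ h1 (Submodule.smul_mem _ _ h2)

theorem IsHomog.deltaH {M : DGBimod A} {m : ℕ} {n : ℤ} {f : A.bars m →ₗ[K] M}
    (hf : M.IsHomog m n f) : M.IsHomog (m + 1) (n + 1) (M.deltaH m n f) := fun j z hz => by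
  refine A.bars_map_mem (M.deltaH m n f) (M.gr (j + (n + 1))) (fun p q v t h hv ht => ?_) hz
  obtain ⟨x, hx, rfl⟩ := hv
  change M.deltaH m n f (A.bcons m (A.bar x) t) ∈ _
  rw [deltaH_bcons]
  have h1 := M.l_mem (A.toDGMod.sgn_mem n hx) (hf ht)
  have h2 := M.extend_mem m n f hf ((A.Omega m).l_mem hx (A.barsIncl_mem m ht))
  rw [show p + 1 + (q + n) = j + (n + 1) by omega] at h1
  rw [show p + 1 + q + n = j + (n + 1) by omega] at h2
  exact Submodule.smul_mem _ _ (Submodule.sub_mem _ h1 h2)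

/-- The Hochschild cochains `C^n(A, M) = ∏ m, Hom(s(A / K · 1)^{⊗ m}, M)^n` of degree `n`. -/
def cochains (M : DGBimod A) (n : ℤ) : Submodule K (∀ m : ℕ, A.bars m →ₗ[K] M) where
  carrier := {f | ∀ m, M.IsHomog m n (f m)}
  add_mem' hf hg := fun m _ _ ht => Submodule.add_mem _ (hf m ht) (hg m ht)
  zero_mem' := fun _ _ _ _ => Submodule.zero_mem _
  smul_mem' c _ hf := fun m _ _ ht => Submodule.smul_mem _ c (hf m ht)

/-- The components of the Hochschild differential `δ = δᵛ + δʰ`. -/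
def deltaFun (M : DGBimod A) (n : ℤ) (f : ∀ m : ℕ, A.bars m →ₗ[K] M) :
    ∀ m : ℕ, A.bars m →ₗ[K] M
  | 0 => M.deltaV 0 n (f 0)
  | m + 1 => M.deltaV (m + 1) n (f (m + 1)) + M.deltaH m n (f m)

/-- The Hochschild differential `C^n(A, M) → C^{n + 1}(A, M)`. -/
def delta (M : DGBimod A) (n : ℤ) : M.cochains n →ₗ[K] M.cochains (n + 1) where
  toFun f := ⟨M.deltaFun n f.1, fun m => match m with
    | 0 => (f.2 0).deltaV
    | m + 1 => fun _ _ ht => Submodule.add_mem _ ((f.2 (m + 1)).deltaV ht)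
        ((f.2 m).deltaH ht)⟩
  map_add' f g := Subtype.ext (funext fun m => by
    cases m with
    | zero => exact map_add (M.deltaV 0 n) (f.1 0) (g.1 0)
    | succ m =>
      change M.deltaV (m + 1) n (f.1 (m + 1) + g.1 (m + 1)) + M.deltaH m n (f.1 m + g.1 m) =
        (M.deltaV (m + 1) n (f.1 (m + 1)) + M.deltaH m n (f.1 m)) +
          (M.deltaV (m + 1) n (g.1 (m + 1)) + M.deltaH m n (g.1 m))
      rw [map_add, map_add]; abel)
  map_smul' c f := Subtype.ext (funext fun m => by
    cases m with
    | zero => exact map_smul (M.deltaV 0 n) c (f.1 0)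
    | succ m =>
      change M.deltaV (m + 1) n (c • f.1 (m + 1)) + M.deltaH m n (c • f.1 m) =
        c • (M.deltaV (m + 1) n (f.1 (m + 1)) + M.deltaH m n (f.1 m))
      rw [map_smul, map_smul, smul_add])

theorem delta_delta (M : DGBimod A) (n : ℤ) (f : M.cochains n) :
    M.delta (n + 1) (M.delta n f) = 0 := Subtype.ext (funext fun m => by
  match m with
  | 0 => exact M.deltaV_deltaV 0 n (f.1 0)
  | 1 =>
    change M.deltaV 1 (n + 1) (M.deltaV 1 n (f.1 1) + M.deltaH 0 n (f.1 0)) +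
      M.deltaH 0 (n + 1) (M.deltaV 0 n (f.1 0)) = 0
    rw [map_add, deltaV_deltaV]
    exact (congrArg (· + _) (zero_add _)).trans (M.deltaV_deltaH 0 n _ (f.2 0))
  | m + 2 =>
    change M.deltaV (m + 2) (n + 1) (M.deltaV (m + 2) n (f.1 (m + 2)) +
        M.deltaH (m + 1) n (f.1 (m + 1))) +
      M.deltaH (m + 1) (n + 1) (M.deltaV (m + 1) n (f.1 (m + 1)) + M.deltaH m n (f.1 m)) = 0
    rw [map_add, map_add, deltaV_deltaV, deltaH_deltaH, zero_add, add_zero,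
      M.deltaV_deltaH (m + 1) n _ (f.2 (m + 1))])

/-- The Hochschild cochain complex `C^*(A, M)` of `A` with coefficients in `M`. -/
def complex (M : DGBimod A) : CochainComplex (ModuleCat.{u} K) ℤ :=
  CochainComplex.of (fun n => ModuleCat.of K (M.cochains n)) (fun n => ModuleCat.ofHom (M.delta n))
    (fun n => ModuleCat.hom_ext (LinearMap.ext fun f => M.delta_delta n f))

/-- A morphism of Hochschild cochain complexes, from its components. -/
def complexHom {M : DGBimod A} {N : DGBimod B} (φ : ∀ n, M.cochains n →ₗ[K] N.cochains n)
    (h : ∀ n f, N.delta n (φ n f) = φ (n + 1) (M.delta n f)) : M.complex ⟶ N.complex :=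
  CochainComplex.ofHom (fun n => ModuleCat.ofHom (φ n)) (fun n => by
    simp only [complex, CochainComplex.of_d]
    exact ModuleCat.hom_ext (LinearMap.ext fun f => h n f))

theorem complexHom_comp {C : DGAlg K} {M : DGBimod A} {N : DGBimod B} {P : DGBimod C}
    (φ : ∀ n, M.cochains n →ₗ[K] N.cochains n) (hφ) (ψ : ∀ n, N.cochains n →ₗ[K] P.cochains n) (hψ)
    (χ : ∀ n, M.cochains n →ₗ[K] P.cochains n) (hχ) (h : ∀ n f, ψ n (φ n f) = χ n f) :
    complexHom φ hφ ≫ complexHom ψ hψ = complexHom χ hχ := by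
  ext n f
  exact h n f

/-- The map `C^n(A, M) → C^n(A, N)` given by composition with a morphism `M → N`. -/
def push {M N : DGBimod A} (φ : Hom M N) (n : ℤ) : M.cochains n →ₗ[K] N.cochains n where
  toFun f := ⟨fun m => φ.toLin ∘ₗ f.1 m, fun m _ _ ht => φ.map_mem (f.2 m ht)⟩
  map_add' _ _ := Subtype.ext (funext fun _ => LinearMap.comp_add _ _ _)
  map_smul' _ _ := Subtype.ext (funext fun _ => LinearMap.comp_smul _ _ _)

theorem extend_push {M N : DGBimod A} (φ : Hom M N) (m : ℕ) (f : A.bars m →ₗ[K] M) :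
    N.extend m (φ.toLin ∘ₗ f) = φ.toLin ∘ₗ M.extend m f :=
  N.extend_uniq m _ _ (fun w a => by simp [extend_r, φ.map_r]) (fun t => by simp [extend_incl])

theorem deltaV_push {M N : DGBimod A} (φ : Hom M N) (m : ℕ) (n : ℤ) (f : A.bars m →ₗ[K] M) :
    N.deltaV m n (φ.toLin ∘ₗ f) = φ.toLin ∘ₗ M.deltaV m n f := LinearMap.ext fun t => by
  simp [deltaV_apply, φ.map_d]

theorem deltaH_push {M N : DGBimod A} (φ : Hom M N) (m : ℕ) (n : ℤ) (f : A.bars m →ₗ[K] M) :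
    N.deltaH m n (φ.toLin ∘ₗ f) = φ.toLin ∘ₗ M.deltaH m n f := A.bars_ext fun x t => by
  rw [LinearMap.comp_apply, deltaH_bcons, deltaH_bcons, extend_push, map_smul, map_sub, φ.map_l]
  rfl

theorem delta_push {M N : DGBimod A} (φ : Hom M N) (n : ℤ) (f : M.cochains n) :
    N.delta n (push φ n f) = push φ (n + 1) (M.delta n f) := Subtype.ext (funext fun m => by
  cases m with
  | zero => exact deltaV_push φ 0 n (f.1 0)
  | succ m =>
    change N.deltaV (m + 1) n (φ.toLin ∘ₗ f.1 (m + 1)) + N.deltaH m n (φ.toLin ∘ₗ f.1 m) =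
      φ.toLin ∘ₗ (M.deltaV (m + 1) n (f.1 (m + 1)) + M.deltaH m n (f.1 m))
    rw [deltaV_push, deltaH_push, LinearMap.comp_add])

/-- The map `C^n(B, M) → C^n(A, M)` given by composition with the maps
`s(A / K · 1)^{⊗ m} → s(B / K · 1)^{⊗ m}` induced by a morphism `A → B`. -/
def pull (f : DGAlg.Hom A B) (M : DGBimod B) (n : ℤ) :
    (restrict (DGAlg.Hom.id B) M).cochains n →ₗ[K] (restrict f M).cochains n where
  toFun g := ⟨fun m => g.1 m ∘ₗ f.barsMap m, fun m _ _ ht => g.2 m (f.barsMap_mem m ht)⟩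
  map_add' _ _ := Subtype.ext (funext fun _ => LinearMap.add_comp _ _ _)
  map_smul' _ _ := Subtype.ext (funext fun _ => LinearMap.smul_comp _ _ _)

theorem extend_pull (f : DGAlg.Hom A B) (M : DGBimod B) (m : ℕ) (g : B.bars m →ₗ[K] M) :
    (restrict f M).extend m (g ∘ₗ f.barsMap m) =
      (restrict (DGAlg.Hom.id B) M).extend m g ∘ₗ (f.omegaMap m).toLin :=
  (restrict f M).extend_uniq m _ _
    (fun w a => by
      rw [LinearMap.comp_apply, (f.omegaMap m).map_r]
      exact (restrict (DGAlg.Hom.id B) M).extend_r m g _ _)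
    (fun t => by
      rw [LinearMap.comp_apply, f.omegaMap_incl]
      exact (restrict (DGAlg.Hom.id B) M).extend_incl m g _)

theorem deltaV_pull (f : DGAlg.Hom A B) (M : DGBimod B) (m : ℕ) (n : ℤ) (g : B.bars m →ₗ[K] M) :
    (restrict f M).deltaV m n (g ∘ₗ f.barsMap m) =
      (restrict (DGAlg.Hom.id B) M).deltaV m n g ∘ₗ f.barsMap m := LinearMap.ext fun t => by
  rw [LinearMap.comp_apply, deltaV_apply, deltaV_apply, LinearMap.comp_apply, LinearMap.comp_apply,
    f.barsMap_d]

theorem deltaH_pull (f : DGAlg.Hom A B) (M : DGBimod B) (m : ℕ) (n : ℤ) (g : B.bars m →ₗ[K] M) :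
    (restrict f M).deltaH m n (g ∘ₗ f.barsMap m) =
      (restrict (DGAlg.Hom.id B) M).deltaH m n g ∘ₗ f.barsMap (m + 1) :=
  A.bars_ext fun x t => by
    rw [LinearMap.comp_apply, f.barsMap_bcons, DGAlg.Hom.sbarMap_bar, deltaH_bcons, deltaH_bcons,
      extend_pull]
    have h1 : (f.omegaMap m).toLin ((A.Omega m).l x (A.barsIncl m t)) =
        (B.Omega m).l (f.toAlgHom x) (B.barsIncl m (f.barsMap m t)) :=
      ((f.omegaMap m).map_l x _).trans
        (congrArg ((B.Omega m).l (f.toAlgHom x)) (f.omegaMap_incl m t))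
    have h2 : (restrict f M).l (A.sgn n x) ((g ∘ₗ f.barsMap m) t) =
        (restrict (DGAlg.Hom.id B) M).l (B.sgn n (f.toAlgHom x)) (g (f.barsMap m t)) :=
      congrArg (fun b => M.l b (g (f.barsMap m t))) (f.map_sgn n x)
    rw [h2, ← h1]
    rfl

theorem delta_pull (f : DGAlg.Hom A B) (M : DGBimod B) (n : ℤ)
    (g : (restrict (DGAlg.Hom.id B) M).cochains n) :
    (restrict f M).delta n (pull f M n g) =
      pull f M (n + 1) ((restrict (DGAlg.Hom.id B) M).delta n g) :=
  Subtype.ext (funext fun m => by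
    cases m with
    | zero => exact deltaV_pull f M 0 n (g.1 0)
    | succ m =>
      refine (congrArg₂ (· + ·) (deltaV_pull f M (m + 1) n (g.1 (m + 1)))
        (deltaH_pull f M m n (g.1 m))).trans ?_
      exact (LinearMap.add_comp _ _ _).symm)

/-- The map sending `g : s(A / K · 1)^{⊗ m} → M` of degree `n` to the map
`a ⊗ t ↦ (-1)^(n * (deg a - 1)) f(a) ⊗ g(t)`. -/
def thetaStep (f : DGAlg.Hom A B) (M : DGBimod B) (m : ℕ) (n : ℤ) :
    (A.bars m →ₗ[K] M) →ₗ[K] (A.bars (m + 1) →ₗ[K] omega M) where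
  toFun g := A.blift ((DGMod.tmk B.sbar M.toDGMod).compl₁₂ (B.sbar.sgn n ∘ₗ f.sbarMap) g)
  map_add' g h := A.bars_ext fun x t => by simp
  map_smul' c g := A.bars_ext fun x t => by simp

theorem thetaStep_bcons (f : DGAlg.Hom A B) (M : DGBimod B) (m : ℕ) (n : ℤ)
    (g : A.bars m →ₗ[K] M) (v : A.sbar) (t : A.bars m) :
    thetaStep f M m n g (A.bcons m v t) =
      DGMod.tmk B.sbar M.toDGMod (B.sbar.sgn n (f.sbarMap v)) (g t) := rfl

theorem thetaStep_bar (f : DGAlg.Hom A B) (M : DGBimod B) (m : ℕ) (n : ℤ)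
    (g : A.bars m →ₗ[K] M) (x : A) (t : A.bars m) :
    thetaStep f M m n g (A.bcons m (A.bar x) t) =
      koszulSign K n • DGMod.tmk B.sbar M.toDGMod (B.bar (B.sgn n (f.toAlgHom x))) (g t) := by
  rw [thetaStep_bcons, f.sbarMap_bar, B.sgn_bar, map_smul, LinearMap.smul_apply]

theorem extend_thetaStep (f : DGAlg.Hom A B) (M : DGBimod B) (m : ℕ) (n : ℤ)
    (g : A.bars m →ₗ[K] M) (x : A) (w : A.Omega m) :
    (restrict f (omega M)).extend (m + 1) (thetaStep f M m n g) (A.ocons m (A.bar x) w) =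
      koszulSign K n • DGMod.tmk B.sbar M.toDGMod (B.bar (B.sgn n (f.toAlgHom x)))
        ((restrict f M).extend m g w) := by
  rw [extend_ocons]
  refine LinearMap.congr_fun ((restrict f (omega M)).extend_uniq m _
    (koszulSign K n • (DGMod.tmk B.sbar M.toDGMod (B.bar (B.sgn n (f.toAlgHom x))) ∘ₗ
        (restrict f M).extend m g)) (fun w a => ?_) (fun t => ?_)) w
  · rw [LinearMap.smul_apply, LinearMap.comp_apply, extend_r, LinearMap.smul_apply, map_smul]
    rfl
  · rw [LinearMap.smul_apply, LinearMap.comp_apply, extend_incl, LinearMap.comp_apply,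
      thetaStep_bar]

theorem deltaV_thetaStep (f : DGAlg.Hom A B) (M : DGBimod B) (m : ℕ) (n : ℤ)
    (g : A.bars m →ₗ[K] M) :
    (restrict f (omega M)).deltaV (m + 1) n (thetaStep f M m n g) =
      thetaStep f M m (n + 1) ((restrict f M).deltaV m n g) := A.bars_ext fun x t => by
  have h : B.sgn n (B.sgn 1 (f.toAlgHom x)) = B.sgn (n + 1) (f.toAlgHom x) :=
    (B.toDGMod.sgn_succ n _).symm
  have h2 : B.sgn 1 (B.sgn n (f.toAlgHom x)) = B.sgn (n + 1) (f.toAlgHom x) :=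
    (B.toDGMod.sgn_comm n _).trans h
  have h3 : B.sgn n (B.d (f.toAlgHom x)) = koszulSign K n • B.d (B.sgn n (f.toAlgHom x)) :=
    B.toDGMod.sgn_d n _
  rw [deltaV_apply, thetaStep_bar, thetaStep_bar, DGAlg.d_bcons, map_sub, map_neg, thetaStep_bar,
    thetaStep_bar, map_smul, M.omega_d_bar, deltaV_apply, f.map_d, f.map_sgn, h, h2, h3]
  simp only [koszulSign_succ, map_smul, map_sub, LinearMap.smul_apply, smul_sub, neg_smul,
    smul_neg, smul_smul, koszulSign_mul_self, one_smul, neg_mul]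
  abel

theorem deltaH_thetaStep (f : DGAlg.Hom A B) (M : DGBimod B) (m : ℕ) (n : ℤ)
    (g : A.bars m →ₗ[K] M) :
    (restrict f (omega M)).deltaH (m + 1) n (thetaStep f M m n g) =
      thetaStep f M (m + 1) (n + 1) ((restrict f M).deltaH m n g) := A.bars_ext fun x z => by
  refine LinearMap.congr_fun (A.bars_ext
    (f := (restrict f (omega M)).deltaH (m + 1) n (thetaStep f M m n g) ∘ₗ
      A.bcons (m + 1) (A.bar x))
    (g := thetaStep f M (m + 1) (n + 1) ((restrict f M).deltaH m n g) ∘ₗ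
      A.bcons (m + 1) (A.bar x)) fun y t => ?_) z
  have h : B.sgn n (B.sgn 1 (f.toAlgHom x)) = B.sgn (n + 1) (f.toAlgHom x) :=
    (B.toDGMod.sgn_succ n _).symm
  have h2 : B.sgn 1 (B.sgn n (f.toAlgHom x)) = B.sgn (n + 1) (f.toAlgHom x) :=
    (B.toDGMod.sgn_comm n _).trans h
  have h5 : (restrict f (omega M)).l (A.sgn n x) (DGMod.tmk B.sbar M.toDGMod
        (B.bar (B.sgn n (f.toAlgHom y))) (g t)) =
      DGMod.tmk B.sbar M.toDGMod (B.bar (B.sgn (n + 1) (f.toAlgHom x) * B.sgn n (f.toAlgHom y)))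
          (g t) -
        DGMod.tmk B.sbar M.toDGMod (B.bar (B.sgn (n + 1) (f.toAlgHom x)))
          (M.l (B.sgn n (f.toAlgHom y)) (g t)) := by
    rw [← h2, ← f.map_sgn n x]
    exact M.omegaAct_tmk _ _ _
  have h6 : (restrict f M).l (A.sgn n y) (g t) = M.l (B.sgn n (f.toAlgHom y)) (g t) := by
    rw [← f.map_sgn]; rfl
  rw [LinearMap.comp_apply, LinearMap.comp_apply, deltaH_bcons, thetaStep_bar, thetaStep_bar,
    DGAlg.barsIncl_bcons, DGAlg.l_ocons, map_sub, extend_thetaStep, extend_thetaStep,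
    deltaH_bcons, map_smul, h5, h6, map_mul f.toAlgHom, f.map_sgn, B.sgn_mul, h,
    extend_incl]
  simp only [koszulSign_succ, map_smul, map_sub, smul_sub, neg_smul,
    smul_neg, smul_smul, koszulSign_mul_self, one_smul, neg_mul, map_neg]
  abel

theorem IsHomog.thetaStep {f : DGAlg.Hom A B} {M : DGBimod B} {m : ℕ} {n : ℤ}
    {g : A.bars m →ₗ[K] M} (hg : (restrict f M).IsHomog m n g) :
    (restrict f (omega M)).IsHomog (m + 1) n (thetaStep f M m n g) := fun j z hz => by
  refine A.bars_map_mem (DGBimod.thetaStep f M m n g) ((DGMod.tensor B.sbar M.toDGMod).gr (j + n))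
    (fun p q v t h hv ht => ?_) hz
  rw [thetaStep_bcons]
  exact DGMod.tmk_mem (i := p) (j := q + n) (by omega) (B.sbar.sgn_mem n (f.sbarMap_mem hv)) (hg ht)

/-- The components of the structure map of the inductive system. -/
def thetaFun (f : DGAlg.Hom A B) (M : DGBimod B) (n : ℤ) (g : ∀ m : ℕ, A.bars m →ₗ[K] M) :
    ∀ m : ℕ, A.bars m →ₗ[K] omega M
  | 0 => 0
  | m + 1 => thetaStep f M m n (g m)

/-- The structure map `C^n(A, M) → C^n(A, s(B / K · 1) ⊗ M)` of the inductive system. -/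
def theta (f : DGAlg.Hom A B) (M : DGBimod B) (n : ℤ) :
    (restrict f M).cochains n →ₗ[K] (restrict f (omega M)).cochains n where
  toFun g := ⟨thetaFun f M n g.1, fun m => by
    cases m with
    | zero => exact fun j t _ => Submodule.zero_mem _
    | succ m => exact (g.2 m).thetaStep⟩
  map_add' g h := Subtype.ext (funext fun m => by
    cases m with
    | zero => exact (add_zero (0 : A.bars 0 →ₗ[K] omega M)).symm
    | succ m => exact map_add (thetaStep f M m n) (g.1 m) (h.1 m))
  map_smul' c g := Subtype.ext (funext fun m => by
    cases m with
    | zero => exact (smul_zero (A := A.bars 0 →ₗ[K] omega M) c).symm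
    | succ m => exact map_smul (thetaStep f M m n) c (g.1 m))

theorem delta_theta (f : DGAlg.Hom A B) (M : DGBimod B) (n : ℤ) (g : (restrict f M).cochains n) :
    (restrict f (omega M)).delta n (theta f M n g) =
      theta f M (n + 1) ((restrict f M).delta n g) :=
  Subtype.ext (funext fun m => by
    match m with
    | 0 => exact map_zero ((restrict f (omega M)).deltaV 0 n)
    | 1 =>
      refine (congrArg₂ (· + ·) (deltaV_thetaStep f M 0 n (g.1 0))
        (map_zero ((restrict f (omega M)).deltaH 0 n))).trans ?_
      exact add_zero _
    | m + 2 =>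
      refine (congrArg₂ (· + ·) (deltaV_thetaStep f M (m + 1) n (g.1 (m + 1)))
        (deltaH_thetaStep f M m n (g.1 m))).trans ?_
      exact (map_add (thetaStep f M (m + 1) (n + 1)) _ _).symm)

end DGBimod

namespace DGAlg

variable {K : Type u} [CommRing K] {A B : DGAlg K}

/-- The Hochschild cochain complex `C^*(A, Ω^p(B))`, where `Ω^p(B)` is an `A`-`A`-bimodule via a
morphism of dg algebras `A → B`. -/
def Hom.formComplex (f : Hom A B) (p : ℕ) : CochainComplex (ModuleCat.{u} K) ℤ :=
  (DGBimod.restrict f (B.Omega p)).complex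

/-- The structure map `θ_p : C^*(A, Ω^p(B)) → C^*(A, Ω^{p + 1}(B))`. -/
def Hom.thetaMap (f : Hom A B) (p : ℕ) : f.formComplex p ⟶ f.formComplex (p + 1) :=
  DGBimod.complexHom (M := DGBimod.restrict f (B.Omega p))
    (N := DGBimod.restrict f (DGBimod.omega (B.Omega p)))
    (DGBimod.theta f (B.Omega p)) (DGBimod.delta_theta f (B.Omega p))

/-- The inductive system of the complexes `C^*(A, Ω^p(B))`. -/
def Hom.formSystem (f : Hom A B) : ℕ ⥤ CochainComplex (ModuleCat.{u} K) ℤ :=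
  Functor.ofSequence f.thetaMap

/-- The singular Hochschild cochain complex `C_sg^*(A, B)` of `A` with coefficients in `B`,
the colimit over `p` of the complexes `C^*(A, Ω^p(B))`. -/
def Hom.Csg (f : Hom A B) : CochainComplex (ModuleCat.{u} K) ℤ := colimit f.formSystem

/-- The singular Hochschild cochain complex `C_sg^*(A, A)` of `A`. -/
def Csg (A : DGAlg K) : CochainComplex (ModuleCat.{u} K) ℤ := (Hom.id A).Csg

/-- The map `Ω^p(f) : Ω^p(A) → Ω^p(B)`, as a morphism between the coefficients of
`C^*(A, Ω^p(A))` and `C^*(A, Ω^p(B))`. -/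
def Hom.coeffMap (f : Hom A B) (p : ℕ) :
    DGBimod.Hom (DGBimod.restrict (Hom.id A) (A.Omega p)) (DGBimod.restrict f (B.Omega p)) where
  toLin := (f.omegaMap p).toLin
  map_mem := (f.omegaMap p).map_mem
  map_d := (f.omegaMap p).map_d
  map_l := (f.omegaMap p).map_l
  map_r := (f.omegaMap p).map_r

/-- The morphism `C^*(A, Ω^p(f)) : C^*(A, Ω^p(A)) → C^*(A, Ω^p(B))`. -/
def Hom.formPush (f : Hom A B) (p : ℕ) : (Hom.id A).formComplex p ⟶ f.formComplex p :=
  DGBimod.complexHom (DGBimod.push (f.coeffMap p)) (DGBimod.delta_push (f.coeffMap p))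

/-- The morphism `C^*(f, Ω^p(B)) : C^*(B, Ω^p(B)) → C^*(A, Ω^p(B))`. -/
def Hom.formPull (f : Hom A B) (p : ℕ) : (Hom.id B).formComplex p ⟶ f.formComplex p :=
  DGBimod.complexHom (DGBimod.pull f (B.Omega p)) (DGBimod.delta_pull f (B.Omega p))

theorem Hom.sbarMap_sgn (f : Hom A B) (n : ℤ) (v : A.sbar) :
    f.sbarMap (A.sbar.sgn n v) = B.sbar.sgn n (f.sbarMap v) := by
  obtain ⟨x, rfl⟩ := A.bar_surjective v
  rw [A.sgn_bar, map_smul, f.sbarMap_bar, f.sbarMap_bar, f.map_sgn, B.sgn_bar]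

theorem Hom.id_sbarMap (v : A.sbar) : (Hom.id A).sbarMap v = v := by
  obtain ⟨x, rfl⟩ := A.bar_surjective v
  rfl

theorem Hom.thetaMap_formPush (f : Hom A B) (p : ℕ) :
    (Hom.id A).thetaMap p ≫ f.formPush (p + 1) = f.formPush p ≫ f.thetaMap p := by
  ext n g
  refine Subtype.ext (funext fun m => ?_)
  cases m with
  | zero => exact LinearMap.comp_zero _
  | succ m =>
    refine A.bars_ext fun x t => ?_
    change DGMod.tmk B.sbar (B.Omega p).toDGMod
        (f.sbarMap (A.sbar.sgn n ((Hom.id A).sbarMap (A.bar x))))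
          ((f.omegaMap p).toLin (g.1 m t)) =
      DGMod.tmk B.sbar (B.Omega p).toDGMod (B.sbar.sgn n (f.sbarMap (A.bar x)))
          ((f.omegaMap p).toLin (g.1 m t))
    rw [Hom.id_sbarMap, f.sbarMap_sgn]

theorem Hom.thetaMap_formPull (f : Hom A B) (p : ℕ) :
    (Hom.id B).thetaMap p ≫ f.formPull (p + 1) = f.formPull p ≫ f.thetaMap p := by
  ext n g
  refine Subtype.ext (funext fun m => ?_)
  cases m with
  | zero => exact LinearMap.zero_comp _
  | succ m =>
    refine A.bars_ext fun x t => ?_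
    change DGMod.tmk B.sbar (B.Omega p).toDGMod
        (B.sbar.sgn n ((Hom.id B).sbarMap (f.sbarMap (A.bar x)))) (g.1 m (f.barsMap m t)) =
      DGMod.tmk B.sbar (B.Omega p).toDGMod (B.sbar.sgn n (f.sbarMap (A.bar x)))
        (g.1 m (f.barsMap m t))
    rw [Hom.id_sbarMap]

/-- The morphism `C_sg^*(A, f) : C_sg^*(A, A) → C_sg^*(A, B)`. -/
def Hom.CsgPush (f : Hom A B) : A.Csg ⟶ f.Csg :=
  colimMap (NatTrans.ofSequence f.formPush fun p => by
    simp only [formSystem, Functor.ofSequence_map_homOfLE_succ]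
    exact f.thetaMap_formPush p)

/-- The morphism `C_sg^*(f, B) : C_sg^*(B, B) → C_sg^*(A, B)`. -/
def Hom.CsgPull (f : Hom A B) : B.Csg ⟶ f.Csg :=
  colimMap (NatTrans.ofSequence f.formPull fun p => by
    simp only [formSystem, Functor.ofSequence_map_homOfLE_succ]
    exact f.thetaMap_formPull p)

end DGAlg

end

/-!
Each of the two morphisms is a sequential colimit of morphisms of Hochschild cochain complexes,
`C^*(A, Ω^p(f))` or `C^*(f, Ω^p(B))`. Quasi-isomorphisms of complexes of modules are stable under
sequential colimits (`CochainComplex.quasiIso_colimMap`), so it suffices to treat each `p`.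

A morphism `φ` of complexes is a quasi-isomorphism if and only if its cone is exact: whenever
`d x = 0` and `φ x = d y`, there are `x'` and `y'` with `x = d x'` and `y = φ x' - d y'`
(`CochainComplex.quasiIso_iff_cone_exact`). In this form the property passes from the vertical
differential `δᵛ` to the Hochschild differential `δ = δᵛ + δʰ`: as `δʰ` raises the tensor degree `m`
and cochains are products over `m`, the components of `x'` and `y'` can be chosen by recursion on `m`
(`DGBimod.quasiIso_complexHom`). This leaves the maps between the complexes
`Hom(s(A / K · 1)^{⊗ m}, Ω^p(A))`, `Hom(s(A / K · 1)^{⊗ m}, Ω^p(B))` and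
`Hom(s(B / K · 1)^{⊗ m}, Ω^p(B))`, for fixed `m` and `p`.

Over a field, a quasi-isomorphism of dg modules is a homotopy equivalence
(`DGMod.HomotopyInverse.nonempty_of_coneExact`), and homotopy equivalences are preserved by tensor
products and by `Hom` in either variable. If `B` is nonzero, then `s(A / K · 1) → s(B / K · 1)` is a
quasi-isomorphism (`DGAlg.Hom.coneExact_sbarMap`), and the two facts together give the result. If
`B = 0`, that map need not be a quasi-isomorphism, but then `A` is contractible, hence so is
`Ω^p(A) = s(A / K · 1)^{⊗ p} ⊗ A`, while `Ω^p(B) = 0`.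
-/

noncomputable section

/-! ### Quasi-isomorphisms of complexes of modules -/

namespace CochainComplex

variable {K : Type u} [Ring K] {X Y : CochainComplex (ModuleCat.{u} K) ℤ}

/-- A cocycle of a complex of modules is in the image of the cycle object. -/
theorem exists_iCycles_eq (X : CochainComplex (ModuleCat.{u} K) ℤ) (i : ℤ) (x : X.X i)
    (hx : X.d i (i + 1) x = 0) : ∃ z : X.cycles i, X.iCycles i z = x :=
  (ShortComplex.moduleCat_exact_iff _).1
    (ShortComplex.exact_of_f_is_kernel
      (ShortComplex.mk (X.iCycles i) (X.d i (i + 1)) (X.iCycles_d i (i + 1)))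
      (X.cyclesIsKernel i (i + 1) (by simp))) x hx

theorem homologyπ_eq_zero_iff (X : CochainComplex (ModuleCat.{u} K) ℤ) (i : ℤ)
    (z : X.cycles (i + 1)) :
    X.homologyπ (i + 1) z = 0 ↔ ∃ x : X.X i, X.d i (i + 1) x = X.iCycles (i + 1) z := by
  constructor
  · intro h
    obtain ⟨x, hx⟩ := (ShortComplex.moduleCat_exact_iff _).1
      (ShortComplex.exact_of_g_is_cokernel
        (ShortComplex.mk (X.toCycles i (i + 1)) (X.homologyπ (i + 1))
          (X.toCycles_comp_homologyπ i (i + 1)))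
        (X.homologyIsCokernel i (i + 1) (by simp))) z h
    refine ⟨x, ?_⟩
    rw [← hx, ← X.toCycles_i i (i + 1)]
    rfl
  · rintro ⟨x, hx⟩
    have h : X.toCycles i (i + 1) x = z := by
      refine (ModuleCat.mono_iff_injective (X.iCycles (i + 1))).1 inferInstance ?_
      rw [← hx, ← X.toCycles_i i (i + 1)]
      rfl
    rw [← h, ← ModuleCat.comp_apply, X.toCycles_comp_homologyπ]
    rfl

theorem homologyπ_surjective (X : CochainComplex (ModuleCat.{u} K) ℤ) (i : ℤ) :
    Function.Surjective (X.homologyπ i) :=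
  (ModuleCat.epi_iff_surjective (X.homologyπ i)).1 inferInstance

theorem homologyMap_homologyπ (φ : X ⟶ Y) (i : ℤ) (z : X.cycles i) :
    HomologicalComplex.homologyMap φ i (X.homologyπ i z) =
      Y.homologyπ i (HomologicalComplex.cyclesMap φ i z) :=
  ConcreteCategory.congr_hom (HomologicalComplex.homologyπ_naturality φ i) z

theorem iCycles_cyclesMap (φ : X ⟶ Y) (i : ℤ) (z : X.cycles i) :
    Y.iCycles i (HomologicalComplex.cyclesMap φ i z) = φ.f i (X.iCycles i z) :=
  ConcreteCategory.congr_hom (HomologicalComplex.cyclesMap_i φ i) z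

theorem d_iCycles (X : CochainComplex (ModuleCat.{u} K) ℤ) (i : ℤ) (z : X.cycles i) :
    X.d i (i + 1) (X.iCycles i z) = 0 :=
  ConcreteCategory.congr_hom (X.iCycles_d i (i + 1)) z

theorem f_d (φ : X ⟶ Y) (i j : ℤ) (x : X.X i) :
    φ.f j (X.d i j x) = Y.d i j (φ.f i x) :=
  (ConcreteCategory.congr_hom (φ.comm i j) x).symm

/-- A chain map is a quasi-isomorphism if and only if its mapping cone is exact: whenever
`d x = 0` and `φ x = d y`, the pair `(x, y)` is of the form `(d x', φ x' - d y')`. -/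
theorem quasiIso_iff_cone_exact (φ : X ⟶ Y) :
    QuasiIso φ ↔ ∀ (n : ℤ) (x : X.X (n + 1 + 1)) (y : Y.X (n + 1)),
      X.d _ (n + 1 + 1 + 1) x = 0 → φ.f _ x = Y.d (n + 1) (n + 1 + 1) y →
      ∃ (x' : X.X (n + 1)) (y' : Y.X n),
        X.d _ _ x' = x ∧ φ.f _ x' - Y.d n (n + 1) y' = y := by
  constructor
  · intro h n x y hx hxy
    have hbij : ∀ i, Function.Bijective (HomologicalComplex.homologyMap φ i) := fun i =>
      (ConcreteCategory.isIso_iff_bijective _).1 inferInstance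
    obtain ⟨z, rfl⟩ := X.exists_iCycles_eq _ x hx
    have hz : X.homologyπ _ z = 0 := by
      refine (hbij _).1 ?_
      rw [homologyMap_homologyπ, map_zero, homologyπ_eq_zero_iff]
      exact ⟨y, by rw [iCycles_cyclesMap, hxy]⟩
    obtain ⟨x₀, hx₀⟩ := (X.homologyπ_eq_zero_iff _ z).1 hz
    obtain ⟨w, hw⟩ := Y.exists_iCycles_eq (n + 1) (φ.f _ x₀ - y) (by
      rw [map_sub, ← f_d, hx₀, hxy, sub_self])
    obtain ⟨c, hc⟩ := (hbij _).2 (Y.homologyπ _ w)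
    obtain ⟨v, rfl⟩ := X.homologyπ_surjective _ c
    rw [homologyMap_homologyπ, ← sub_eq_zero, ← map_sub, homologyπ_eq_zero_iff] at hc
    obtain ⟨y', hy'⟩ := hc
    refine ⟨x₀ - X.iCycles _ v, -y', ?_, ?_⟩
    · rw [map_sub, d_iCycles, hx₀, sub_zero]
    · rw [map_neg, hy', map_sub, map_sub, iCycles_cyclesMap, hw]
      abel
  · intro h
    rw [quasiIso_iff]
    intro i
    rw [quasiIsoAt_iff_isIso_homologyMap, ConcreteCategory.isIso_iff_bijective]
    constructor
    · obtain ⟨n, rfl⟩ : ∃ n, i = n + 1 + 1 := ⟨i - 1 - 1, by ring⟩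
      rw [injective_iff_map_eq_zero]
      intro c hc
      obtain ⟨z, rfl⟩ := X.homologyπ_surjective _ c
      rw [homologyMap_homologyπ, homologyπ_eq_zero_iff] at hc
      obtain ⟨y, hy⟩ := hc
      rw [iCycles_cyclesMap] at hy
      obtain ⟨x', -, hx', -⟩ := h n _ y (X.d_iCycles _ z) hy.symm
      exact (X.homologyπ_eq_zero_iff _ z).2 ⟨x', hx'⟩
    · obtain ⟨n, rfl⟩ : ∃ n, i = n + 1 := ⟨i - 1, by ring⟩
      intro c
      obtain ⟨w, rfl⟩ := Y.homologyπ_surjective _ c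
      obtain ⟨x', y', hx', hy'⟩ := h n 0 (Y.iCycles _ w) (map_zero _) (by
        rw [map_zero, d_iCycles])
      obtain ⟨z, rfl⟩ := X.exists_iCycles_eq _ x' hx'
      refine ⟨X.homologyπ _ z, ?_⟩
      rw [homologyMap_homologyπ, ← sub_eq_zero, ← map_sub, homologyπ_eq_zero_iff]
      refine ⟨y', ?_⟩
      rw [map_sub, iCycles_cyclesMap, ← hy']
      abel

/-- Sequential colimits of quasi-isomorphisms of complexes of modules are quasi-isomorphisms. -/
theorem quasiIso_colimMap {F G : ℕ ⥤ CochainComplex (ModuleCat.{u} K) ℤ} (α : F ⟶ G)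
    (hα : ∀ p, QuasiIso (α.app p)) : QuasiIso (colimMap α) := by
  have hpres : PreservesColimitsOfShape ℕ (forget (ModuleCat.{u} K)) := by
    have := preservesSmallestFilteredColimits_of_preservesFilteredColimits
      (forget (ModuleCat.{u} K))
    exact PreservesFilteredColimitsOfSize.preserves_filtered_colimits ℕ
  have hc : ∀ (H : ℕ ⥤ CochainComplex (ModuleCat.{u} K) ℤ) (n : ℤ), IsColimit
      ((HomologicalComplex.eval (ModuleCat.{u} K) (ComplexShape.up ℤ) n).mapCocone
        (colimit.cocone H)) := fun H n =>
    isColimitOfPreserves _ (colimit.isColimit H)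
  have hrep : ∀ (H : ℕ ⥤ CochainComplex (ModuleCat.{u} K) ℤ) (n : ℤ)
      (x : (colimit H).X n), ∃ p, ∃ z : (H.obj p).X n, (colimit.ι H p).f n z = x :=
    fun H n x => Concrete.isColimit_exists_rep _ (hc H n) x
  have hzero : ∀ (H : ℕ ⥤ CochainComplex (ModuleCat.{u} K) ℤ) (n : ℤ) (p : ℕ)
      (z : (H.obj p).X n), (colimit.ι H p).f n z = 0 →
      ∃ (q : ℕ) (g : p ⟶ q), (H.map g).f n z = 0 := fun H n p z hz => by
    obtain ⟨q, g, g', hg⟩ := (Concrete.isColimit_rep_eq_iff_exists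
      (H ⋙ HomologicalComplex.eval _ _ n) (hc H n) z (0 : (H.obj p).X n)).1
      (hz.trans (map_zero ((colimit.ι H p).f n).hom).symm)
    exact ⟨q, g, hg.trans (map_zero ((H.map g').f n).hom)⟩
  have hmap : ∀ (H : ℕ ⥤ CochainComplex (ModuleCat.{u} K) ℤ) (n : ℤ) {p q : ℕ} (g : p ⟶ q)
      (z : (H.obj p).X n), (colimit.ι H q).f n ((H.map g).f n z) = (colimit.ι H p).f n z :=
    fun H n p q g z => by
      rw [← ModuleCat.comp_apply, ← HomologicalComplex.comp_f, colimit.w]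
  have hcomm : ∀ (n : ℤ) (p : ℕ) (z : (F.obj p).X n),
      (colimMap α).f n ((colimit.ι F p).f n z) = (colimit.ι G p).f n ((α.app p).f n z) :=
    fun n p z => by
      rw [← ModuleCat.comp_apply, ← HomologicalComplex.comp_f, ι_colimMap]
      rfl
  have hnat : ∀ (n : ℤ) {p q : ℕ} (g : p ⟶ q) (z : (F.obj p).X n),
      (α.app q).f n ((F.map g).f n z) = (G.map g).f n ((α.app p).f n z) := fun n p q g z => by
    rw [← ModuleCat.comp_apply, ← HomologicalComplex.comp_f, α.naturality]
    rfl
  have hd : ∀ (H : ℕ ⥤ CochainComplex (ModuleCat.{u} K) ℤ) {p q : ℕ} (g : p ⟶ q) (i j : ℤ)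
      (x : (H.obj p).X i), (H.map g).f j ((H.obj p).d i j x) =
        (H.obj q).d i j ((H.map g).f i x) := fun H p q g i j x => f_d (H.map g) i j x
  rw [quasiIso_iff_cone_exact]
  intro n x y hx hxy
  -- Represent `x` and `y` at a common stage, and move on until both equations hold there.
  obtain ⟨p₁, x, rfl⟩ := hrep F _ x
  obtain ⟨p₂, y, rfl⟩ := hrep G _ y
  obtain ⟨p, g₁, g₂, -⟩ := IsFilteredOrEmpty.cocone_objs p₁ p₂
  rw [← hmap F _ g₁] at hx hxy
  rw [← hmap G _ g₂] at hxy ⊢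
  rw [← hmap F _ g₁]
  generalize (F.map g₁).f _ x = x at *
  generalize (G.map g₂).f _ y = y at *
  rw [← f_d] at hx
  rw [hcomm, ← f_d, ← sub_eq_zero, ← map_sub] at hxy
  obtain ⟨q, g, hg⟩ := hzero _ _ _ _ hx
  rw [← hmap G _ g, map_sub, ← hnat, hd] at hxy
  rw [hd] at hg
  rw [← hmap G _ g, ← hmap F _ g]
  generalize (F.map g).f _ x = x at *
  generalize (G.map g).f _ y = y at *
  obtain ⟨r, k, hk⟩ := hzero _ _ _ _ hxy
  rw [map_sub, ← hnat, hd, sub_eq_zero] at hk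
  have hk2 := congrArg ((F.map k).f _) hg
  rw [hd, map_zero] at hk2
  obtain ⟨x', y', hx', hy'⟩ := (quasiIso_iff_cone_exact (α.app r)).1 (hα r) n _ _ hk2 hk
  refine ⟨(colimit.ι F r).f _ x', (colimit.ι G r).f _ y', ?_, ?_⟩
  · rw [← f_d, hx', hmap]
  · rw [hcomm, ← f_d, ← map_sub, hy', hmap]

end CochainComplex

/-! ### Exactness of mapping cones -/

/-- Let `φ` be a linear map between modules `X` and `Y` that carry, in every degree `n`, a
submodule of elements of degree `n` and a map `dX n` or `dY n`, to be thought of as the differential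
on elements of degree `n`. The condition says that the mapping cone of `φ`, whose differential is
`(x, y) ↦ (d x, φ x - d y)`, is exact. -/
def ConeExact {K X Y : Type u} [CommRing K] [AddCommGroup X] [Module K X] [AddCommGroup Y]
    [Module K Y] (grX : ℤ → Submodule K X) (dX : ℤ → X →ₗ[K] X) (grY : ℤ → Submodule K Y)
    (dY : ℤ → Y →ₗ[K] Y) (φ : X →ₗ[K] Y) : Prop :=
  ∀ (n : ℤ) (x : X) (y : Y), x ∈ grX (n + 1 + 1) → y ∈ grY (n + 1) →
    dX (n + 1 + 1) x = 0 → φ x = dY (n + 1) y →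
    ∃ x' ∈ grX (n + 1), ∃ y' ∈ grY n, dX (n + 1) x' = x ∧ φ x' - dY n y' = y

/-- A map with a homotopy inverse `g` has an exact cone; `a` and `e` are the homotopies
`g φ ∼ 1` and `φ g ∼ 1`. -/
theorem ConeExact.of_homotopy {K X Y : Type u} [CommRing K] [AddCommGroup X] [Module K X]
    [AddCommGroup Y] [Module K Y] {grX : ℤ → Submodule K X} {dX : ℤ → X →ₗ[K] X}
    {grY : ℤ → Submodule K Y} {dY : ℤ → Y →ₗ[K] Y} {φ : X →ₗ[K] Y} (g : Y →ₗ[K] X)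
    (a : ℤ → X →ₗ[K] X) (e : ℤ → Y →ₗ[K] Y)
    (φ_mem : ∀ n x, x ∈ grX n → φ x ∈ grY n) (φ_d : ∀ n x, φ (dX n x) = dY n (φ x))
    (g_mem : ∀ n y, y ∈ grY n → g y ∈ grX n) (g_d : ∀ n y, g (dY n y) = dX n (g y))
    (a_mem : ∀ n x, x ∈ grX (n + 1) → a (n + 1) x ∈ grX n)
    (e_mem : ∀ n y, y ∈ grY (n + 1) → e (n + 1) y ∈ grY n)
    (ha : ∀ n x, g (φ x) - x = dX n (a (n + 1) x) + a (n + 1 + 1) (dX (n + 1) x))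
    (he : ∀ n y, φ (g y) - y = dY n (e (n + 1) y) + e (n + 1 + 1) (dY (n + 1) y)) :
    ConeExact grX dX grY dY φ := by
  intro n x y hx hy hdx hxy
  -- `x₀ = g y - a x` bounds `x`; the cocycle `w` measures the failure of `(x₀, e y)` to bound
  -- `(x, y)`, and the correction by `(g w, e w)` repairs it.
  obtain ⟨w, hw⟩ : ∃ w, w = e (n + 1 + 1) (φ x) - φ (a (n + 1 + 1) x) := ⟨_, rfl⟩
  have h1 := ha (n + 1) x
  rw [hdx, map_zero, add_zero] at h1
  have h2 := he (n + 1) (φ x)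
  rw [← φ_d, hdx, map_zero, map_zero, add_zero] at h2
  have hdw : dY (n + 1) w = 0 := by
    rw [hw, map_sub, ← h2, ← φ_d, ← h1, map_sub, sub_self]
  have hwm : w ∈ grY (n + 1) := hw ▸
    Submodule.sub_mem _ (e_mem _ _ (φ_mem _ _ hx)) (φ_mem _ _ (a_mem _ _ hx))
  have h3 := he n w
  rw [hdw, map_zero, add_zero] at h3
  have h4 := he n y
  rw [← hxy] at h4
  refine ⟨g y - a (n + 1 + 1) x - g w, ?_, e (n + 1) y - e (n + 1) w, ?_, ?_, ?_⟩
  · exact Submodule.sub_mem _ (Submodule.sub_mem _ (g_mem _ _ hy) (a_mem _ _ hx)) (g_mem _ _ hwm)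
  · exact Submodule.sub_mem _ (e_mem _ _ hy) (e_mem _ _ hwm)
  · rw [map_sub, map_sub, ← g_d, ← g_d, hdw, map_zero, sub_zero, ← h1, hxy]
    abel
  · rw [map_sub, map_sub, map_sub, ← h3, eq_sub_of_add_eq h4.symm, hw]
    abel

/-- Over a field, each linear map has a generalized inverse. -/
theorem LinearMap.exists_comp_comp_eq_self {K : Type u} [Field K] {V W : Type*}
    [AddCommGroup V] [Module K V] [AddCommGroup W] [Module K W] (f : V →ₗ[K] W) :
    ∃ s : W →ₗ[K] V, f ∘ₗ s ∘ₗ f = f := by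
  obtain ⟨s, hs⟩ := f.rangeRestrict.exists_rightInverse_of_surjective f.range_rangeRestrict
  obtain ⟨s', hs'⟩ := s.exists_extend
  refine ⟨s', LinearMap.ext fun v => ?_⟩
  have h1 : s' (f v) = s (f.rangeRestrict v) := LinearMap.congr_fun hs' (f.rangeRestrict v)
  have h2 := congrArg Subtype.val (LinearMap.congr_fun hs (f.rangeRestrict v))
  simpa [h1] using h2

/-! ### Homotopy equivalences of dg modules and their tensor products -/

namespace DGMod

variable {K : Type u}

section CommRing

variable [CommRing K]

/-- A morphism of dg modules, as a property of a linear map: it preserves degrees and commutes with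
the differentials. -/
structure IsChainMap {M N : DGMod K} (φ : M →ₗ[K] N) : Prop where
  map_mem : ∀ {n : ℤ} {x : M}, x ∈ M.gr n → φ x ∈ N.gr n
  map_d : ∀ x : M, φ (M.d x) = N.d (φ x)

/-- A homotopy inverse of a morphism of dg modules, with the two homotopies. -/
structure HomotopyInverse {M N : DGMod K} (φ : M →ₗ[K] N) where
  inv : N →ₗ[K] M
  isChainMap : IsChainMap inv
  left : M →ₗ[K] M
  left_mem : ∀ {n : ℤ} {x : M}, x ∈ M.gr (n + 1) → left x ∈ M.gr n
  left_eq : ∀ x : M, inv (φ x) - x = M.d (left x) + left (M.d x)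
  right : N →ₗ[K] N
  right_mem : ∀ {n : ℤ} {y : N}, y ∈ N.gr (n + 1) → right y ∈ N.gr n
  right_eq : ∀ y : N, φ (inv y) - y = N.d (right y) + right (N.d y)

theorem IsChainMap.map_sgn {M N : DGMod K} {φ : M →ₗ[K] N} (hφ : IsChainMap φ) (n : ℤ) (x : M) :
    φ (M.sgn n x) = N.sgn n (φ x) := by
  have : φ ∘ₗ M.sgn n = N.sgn n ∘ₗ φ := M.hom_ext fun i x hx => by
    simp [sgn_of_mem M n hx, sgn_of_mem N n (hφ.map_mem hx)]
  exact LinearMap.congr_fun this x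

/-- Maps of degree `-1` anticommute with the sign `x ↦ (-1)^(deg x) x`. -/
theorem sgn_map_of_degree_neg_one {M : DGMod K} (a : M →ₗ[K] M)
    (ha : ∀ {n : ℤ} {x : M}, x ∈ M.gr (n + 1) → a x ∈ M.gr n) (x : M) :
    M.sgn 1 (a x) = -a (M.sgn 1 x) := by
  have : M.sgn 1 ∘ₗ a = -(a ∘ₗ M.sgn 1) := M.hom_ext fun i x hx => by
    obtain ⟨n, rfl⟩ : ∃ n, i = n + 1 := ⟨i - 1, by ring⟩
    simp [sgn_of_mem M 1 hx, sgn_of_mem M 1 (ha hx), koszulSign_succ]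
  exact LinearMap.congr_fun this x

/-- The tensor product of two linear maps. -/
def tmap {M M' N N' : DGMod K} (φ : M →ₗ[K] M') (ψ : N →ₗ[K] N') :
    tensor M N →ₗ[K] tensor M' N' :=
  tlift ((tmk M' N').compl₁₂ φ ψ)

@[simp] theorem tmap_tmk {M M' N N' : DGMod K} (φ : M →ₗ[K] M') (ψ : N →ₗ[K] N') (x : M) (y : N) :
    tmap φ ψ (tmk M N x y) = tmk M' N' (φ x) (ψ y) := rfl

theorem tmap_mem {M M' N N' : DGMod K} {φ : M →ₗ[K] M'} {ψ : N →ₗ[K] N'} {n k : ℤ}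
    (h : ∀ i j : ℤ, i + j = n → ∃ i' j', i' + j' = k ∧ (∀ x ∈ M.gr i, φ x ∈ M'.gr i') ∧
      ∀ y ∈ N.gr j, ψ y ∈ N'.gr j')
    {z : tensor M N} (hz : z ∈ (tensor M N).gr n) : tmap φ ψ z ∈ (tensor M' N').gr k :=
  tensor_map_mem _ _ (fun i j x y hij hx hy => by
    obtain ⟨i', j', hk, h1, h2⟩ := h i j hij
    exact tmk_mem hk (h1 x hx) (h2 y hy)) hz

theorem IsChainMap.tmap {M M' N N' : DGMod K} {φ : M →ₗ[K] M'} {ψ : N →ₗ[K] N'}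
    (hφ : IsChainMap φ) (hψ : IsChainMap ψ) : IsChainMap (tmap φ ψ) where
  map_mem := tmap_mem fun i j h => ⟨i, j, h, fun _ => hφ.map_mem, fun _ => hψ.map_mem⟩
  map_d z := by
    refine LinearMap.congr_fun (tensor_ext (f := DGMod.tmap φ ψ ∘ₗ (tensor M N).d)
      (g := (tensor M' N').d ∘ₗ DGMod.tmap φ ψ) fun x y => ?_) z
    simp [d_tmk, hφ.map_d, hψ.map_d, hφ.map_sgn]

/-- For homotopies `a : u ∼ 1` and `a' : u' ∼ 1`, the map
`x ⊗ y ↦ a x ⊗ u' y + (-1)^(deg x) x ⊗ a' y` is a homotopy `u ⊗ u' ∼ 1`. -/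
theorem tmap_homotopy {M N : DGMod K} {u a : M →ₗ[K] M} {u' a' : N →ₗ[K] N}
    (hu' : IsChainMap u') (ha : ∀ {n : ℤ} {x : M}, x ∈ M.gr (n + 1) → a x ∈ M.gr n)
    (h : ∀ x, u x - x = M.d (a x) + a (M.d x)) (h' : ∀ y, u' y - y = N.d (a' y) + a' (N.d y))
    (z : tensor M N) : tmap u u' z - z =
      (tensor M N).d ((tmap a u' + tmap (M.sgn 1) a') z) +
        (tmap a u' + tmap (M.sgn 1) a') ((tensor M N).d z) := by
  refine LinearMap.congr_fun (tensor_ext (f := tmap u u' - LinearMap.id)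
    (g := (tensor M N).d ∘ₗ (tmap a u' + tmap (M.sgn 1) a') +
      (tmap a u' + tmap (M.sgn 1) a') ∘ₗ (tensor M N).d) fun x y => ?_) z
  have h1 : u x = x + M.d (a x) + a (M.d x) := by
    rw [add_assoc, ← h]; abel
  have h2 : u' y = y + N.d (a' y) + a' (N.d y) := by
    rw [add_assoc, ← h']; abel
  simp only [LinearMap.sub_apply, LinearMap.add_apply, LinearMap.comp_apply, LinearMap.id_apply,
    tmap_tmk, map_add, d_tmk, ← hu'.map_d, sgn_map_of_degree_neg_one a ha, sgn_d, sgn_sgn,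
    koszulSign_one, neg_smul, one_smul, map_neg, LinearMap.neg_apply]
  have h3 : tmk M N (u x) (u' y) = tmk M N x (u' y) + tmk M N (M.d (a x)) (u' y) +
      tmk M N (a (M.d x)) (u' y) := by
    rw [h1]; simp only [map_add, LinearMap.add_apply]
  have h4 : tmk M N x (u' y) = tmk M N x y + tmk M N x (N.d (a' y)) +
      tmk M N x (a' (N.d y)) := by
    rw [h2]; simp only [map_add]
  rw [h3, h4]
  abel

theorem tmap_homotopy_mem {M N : DGMod K} {a : M →ₗ[K] M} {u' a' : N →ₗ[K] N}
    (hu' : IsChainMap u') (ha : ∀ {n : ℤ} {x : M}, x ∈ M.gr (n + 1) → a x ∈ M.gr n)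
    (ha' : ∀ {n : ℤ} {y : N}, y ∈ N.gr (n + 1) → a' y ∈ N.gr n) {n : ℤ} {z : tensor M N}
    (hz : z ∈ (tensor M N).gr (n + 1)) :
    (tmap a u' + tmap (M.sgn 1) a') z ∈ (tensor M N).gr n :=
  Submodule.add_mem _
    (tmap_mem (fun i j h => ⟨i - 1, j, by omega,
      fun x hx => ha (by rwa [sub_add_cancel]), fun y hy => hu'.map_mem hy⟩) hz)
    (tmap_mem (fun i j h => ⟨i, j - 1, by omega,
      fun x hx => M.sgn_mem 1 hx, fun y hy => ha' (by rwa [sub_add_cancel])⟩) hz)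

theorem IsChainMap.comp {M N P : DGMod K} {ψ : N →ₗ[K] P} {φ : M →ₗ[K] N} (hψ : IsChainMap ψ)
    (hφ : IsChainMap φ) : IsChainMap (ψ ∘ₗ φ) :=
  ⟨fun hx => hψ.map_mem (hφ.map_mem hx), fun x => by simp [hφ.map_d, hψ.map_d]⟩

theorem IsChainMap.id (M : DGMod K) : IsChainMap (LinearMap.id : M →ₗ[K] M) :=
  ⟨fun h => h, fun _ => rfl⟩

theorem tmap_comp {M M' M'' N N' N'' : DGMod K} (φ' : M' →ₗ[K] M'') (ψ' : N' →ₗ[K] N'')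
    (φ : M →ₗ[K] M') (ψ : N →ₗ[K] N') (z : tensor M N) :
    tmap φ' ψ' (tmap φ ψ z) = tmap (φ' ∘ₗ φ) (ψ' ∘ₗ ψ) z :=
  LinearMap.congr_fun (tensor_ext (f := tmap φ' ψ' ∘ₗ tmap φ ψ)
    (g := tmap (φ' ∘ₗ φ) (ψ' ∘ₗ ψ)) fun _ _ => rfl) z

/-- Tensor products of homotopy equivalences are homotopy equivalences. -/
def HomotopyInverse.tmap {M M' N N' : DGMod K} {φ : M →ₗ[K] M'} {ψ : N →ₗ[K] N'}
    (h : HomotopyInverse φ) (h' : HomotopyInverse ψ) (hψ : IsChainMap ψ) :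
    HomotopyInverse (DGMod.tmap φ ψ) where
  inv := DGMod.tmap h.inv h'.inv
  isChainMap := h.isChainMap.tmap h'.isChainMap
  left := DGMod.tmap h.left (h'.inv ∘ₗ ψ) + DGMod.tmap (M.sgn 1) h'.left
  left_mem := tmap_homotopy_mem (h'.isChainMap.comp hψ) h.left_mem h'.left_mem
  left_eq z := by
    rw [tmap_comp]
    exact tmap_homotopy (h'.isChainMap.comp hψ) h.left_mem h.left_eq h'.left_eq z
  right := DGMod.tmap h.right (ψ ∘ₗ h'.inv) + DGMod.tmap (M'.sgn 1) h'.right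
  right_mem := tmap_homotopy_mem (hψ.comp h'.isChainMap) h.right_mem h'.right_mem
  right_eq z := by
    rw [tmap_comp]
    exact tmap_homotopy (hψ.comp h'.isChainMap) h.right_mem h.right_eq h'.right_eq z

/-- The identity is its own homotopy inverse. -/
def HomotopyInverse.id (M : DGMod K) : HomotopyInverse (LinearMap.id : M →ₗ[K] M) where
  inv := LinearMap.id
  isChainMap := IsChainMap.id M
  left := 0
  left_mem _ := Submodule.zero_mem _
  left_eq x := by simp
  right := 0
  right_mem _ := Submodule.zero_mem _
  right_eq x := by simp

/-- A dg module that is homotopy equivalent to a zero module is contractible, so that each map from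
it to a zero module is a homotopy equivalence. -/
def HomotopyInverse.ofSubsingleton {M N N' : DGMod K} {φ : M →ₗ[K] N} (h : HomotopyInverse φ)
    [Subsingleton N] [Subsingleton N'] (φ' : M →ₗ[K] N') : HomotopyInverse φ' where
  inv := 0
  isChainMap := ⟨fun _ => Submodule.zero_mem _, fun _ => (map_zero _).symm⟩
  left := h.left
  left_mem := h.left_mem
  left_eq x := by
    rw [← h.left_eq, Subsingleton.elim (φ x) 0, map_zero, LinearMap.zero_apply]
  right := 0
  right_mem _ := Submodule.zero_mem _
  right_eq _ := Subsingleton.elim _ _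

/-! ### Complexes of linear maps -/

/-- The linear maps `T → M` of degree `n`. -/
def homGr (T M : DGMod K) (n : ℤ) : Submodule K (T →ₗ[K] M) where
  carrier := {f | ∀ ⦃j : ℤ⦄ ⦃t : T⦄, t ∈ T.gr j → f t ∈ M.gr (j + n)}
  add_mem' hf hg := fun _ _ ht => Submodule.add_mem _ (hf ht) (hg ht)
  zero_mem' := fun _ _ _ => Submodule.zero_mem _
  smul_mem' c _ hf := fun _ _ ht => Submodule.smul_mem _ c (hf ht)

/-- The differential `f ↦ d ∘ f - (-1)^n f ∘ d` on maps `f` of degree `n`. -/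
def homD (T M : DGMod K) (n : ℤ) : (T →ₗ[K] M) →ₗ[K] (T →ₗ[K] M) where
  toFun f := M.d ∘ₗ f - koszulSign K n • (f ∘ₗ T.d)
  map_add' f g := by ext; simp; abel
  map_smul' c f := by ext; simp [smul_sub, smul_smul, mul_comm]

theorem homD_apply (T M : DGMod K) (n : ℤ) (f : T →ₗ[K] M) (t : T) :
    homD T M n f t = M.d (f t) - koszulSign K n • f (T.d t) := rfl

/-- Composition with a homotopy equivalence of dg modules has an exact cone. -/
theorem HomotopyInverse.coneExact_push {M N : DGMod K} {φ : M →ₗ[K] N} (h : HomotopyInverse φ)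
    (hφ : IsChainMap φ) (T : DGMod K) :
    ConeExact (homGr T M) (homD T M) (homGr T N) (homD T N) (LinearMap.llcomp K T M N φ) := by
  refine ConeExact.of_homotopy (LinearMap.llcomp K T N M h.inv)
    (fun _ => LinearMap.llcomp K T M M h.left) (fun _ => LinearMap.llcomp K T N N h.right)
    (fun n f hf j t ht => hφ.map_mem (hf ht)) (fun n f => LinearMap.ext fun t => ?_)
    (fun n f hf j t ht => h.isChainMap.map_mem (hf ht)) (fun n f => LinearMap.ext fun t => ?_)
    (fun n f hf j t ht => h.left_mem (by rw [add_assoc]; exact hf ht))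
    (fun n f hf j t ht => h.right_mem (by rw [add_assoc]; exact hf ht))
    (fun n f => LinearMap.ext fun t => ?_) (fun n f => LinearMap.ext fun t => ?_)
  · simp [homD_apply, hφ.map_d]
  · simp [homD_apply, h.isChainMap.map_d]
  · simp [homD_apply, h.left_eq, koszulSign_succ]
  · simp [homD_apply, h.right_eq, koszulSign_succ]

/-- Precomposition with a homotopy equivalence of dg modules has an exact cone. -/
theorem HomotopyInverse.coneExact_pull {T T' : DGMod K} {ψ : T →ₗ[K] T'} (h : HomotopyInverse ψ)
    (hψ : IsChainMap ψ) (M : DGMod K) :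
    ConeExact (homGr T' M) (homD T' M) (homGr T M) (homD T M) (LinearMap.lcomp K M ψ) := by
  refine ConeExact.of_homotopy (LinearMap.lcomp K M h.inv)
    (fun n => koszulSign K n • LinearMap.lcomp K M h.right)
    (fun n => koszulSign K n • LinearMap.lcomp K M h.left)
    (fun n f hf j t ht => hf (hψ.map_mem ht)) (fun n f => LinearMap.ext fun t => ?_)
    (fun n f hf j t ht => hf (h.isChainMap.map_mem ht)) (fun n f => LinearMap.ext fun t => ?_)
    (fun n f hf => Submodule.smul_mem _ _ fun j t ht => ?_)
    (fun n f hf => Submodule.smul_mem _ _ fun j t ht => ?_)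
    (fun n f => LinearMap.ext fun t => ?_) (fun n f => LinearMap.ext fun t => ?_)
  · simp [homD_apply, hψ.map_d]
  · simp [homD_apply, h.isChainMap.map_d]
  · have h1 := hf (h.right_mem (n := j - 1) (by rwa [sub_add_cancel]))
    rwa [show j - 1 + (n + 1) = j + n by ring] at h1
  · have h1 := hf (h.left_mem (n := j - 1) (by rwa [sub_add_cancel]))
    rwa [show j - 1 + (n + 1) = j + n by ring] at h1
  · have h1 : f (ψ (h.inv t)) - f t = f (T'.d (h.right t)) + f (h.right (T'.d t)) := by
      rw [← map_sub, h.right_eq, map_add]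
    change f (ψ (h.inv t)) - f t = (M.d (koszulSign K (n + 1) • f (h.right t)) -
        koszulSign K n • koszulSign K (n + 1) • f (h.right (T'.d t))) +
      koszulSign K (n + 1 + 1) • (M.d (f (h.right t)) -
        koszulSign K (n + 1) • f (T'.d (h.right t)))
    rw [h1]
    simp only [map_smul, smul_smul, smul_sub]
    simp only [koszulSign_succ, neg_neg, mul_neg, koszulSign_mul_self, neg_smul, one_smul]
    abel
  · have h1 : f (h.inv (ψ t)) - f t = f (T.d (h.left t)) + f (h.left (T.d t)) := by
      rw [← map_sub, h.left_eq, map_add]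
    change f (h.inv (ψ t)) - f t = (M.d (koszulSign K (n + 1) • f (h.left t)) -
        koszulSign K n • koszulSign K (n + 1) • f (h.left (T.d t))) +
      koszulSign K (n + 1 + 1) • (M.d (f (h.left t)) -
        koszulSign K (n + 1) • f (T.d (h.left t)))
    rw [h1]
    simp only [map_smul, smul_smul, smul_sub]
    simp only [koszulSign_succ, neg_neg, mul_neg, koszulSign_mul_self, neg_smul, one_smul]
    abel

end CommRing

/-! ### Homotopy inverses over a field -/

section Field

variable [Field K]

/-- The linear map out of a dg module that is `σ i` on elements of degree `i`. -/
def ofComponents (M : DGMod K) {P : Type u} [AddCommGroup P] [Module K P] (σ : ℤ → M →ₗ[K] P) :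
    M →ₗ[K] P :=
  (DirectSum.toModule K ℤ P fun i => σ i ∘ₗ (M.gr i).subtype) ∘ₗ
    (DirectSum.decomposeLinearEquiv M.gr).toLinearMap

theorem ofComponents_of_mem (M : DGMod K) {P : Type u} [AddCommGroup P] [Module K P]
    (σ : ℤ → M →ₗ[K] P) {i : ℤ} {x : M} (hx : x ∈ M.gr i) : M.ofComponents σ x = σ i x := by
  simp only [ofComponents, LinearMap.comp_apply, LinearEquiv.coe_coe,
    DirectSum.decomposeLinearEquiv_apply]
  rw [DirectSum.decompose_of_mem _ hx]
  exact (DirectSum.toModule_lof K i _).trans rfl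

/-- Over a field, a morphism of dg modules with an exact cone is a homotopy equivalence: a
contraction of the cone, which exists because the cone splits, has the homotopy inverse and the
homotopies among its matrix entries. -/
theorem HomotopyInverse.nonempty_of_coneExact {M N : DGMod K} {φ : M →ₗ[K] N}
    (hφ : IsChainMap φ) (h : ConeExact M.gr (fun _ => M.d) N.gr (fun _ => N.d) φ) :
    Nonempty (HomotopyInverse φ) := by
  -- The cone and its differential; `P n` holds the pairs of degrees `n + 1` and `n`.
  let D : (M × N) →ₗ[K] (M × N) :=
    (M.d ∘ₗ LinearMap.fst K M N).prod (φ ∘ₗ LinearMap.fst K M N - N.d ∘ₗ LinearMap.snd K M N)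
  have hD : ∀ x y, D (x, y) = (M.d x, φ x - N.d y) := fun _ _ => rfl
  have hDD : ∀ z, D (D z) = 0 := by
    rintro ⟨x, y⟩
    simp [hD, M.d_d, N.d_d, hφ.map_d]
  let P : ℤ → Submodule K (M × N) := fun n => (M.gr (n + 1)).prod (N.gr n)
  have hDP : ∀ n z, z ∈ P n → D z ∈ P (n + 1) := by
    rintro n ⟨x, y⟩ ⟨hx, hy⟩
    exact ⟨M.d_mem hx, Submodule.sub_mem _ (hφ.map_mem hx) (N.d_mem hy)⟩
  have hexact : ∀ n z, z ∈ P (n + 1) → D z = 0 → ∃ z' ∈ P n, D z' = z := by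
    rintro n ⟨x, y⟩ ⟨hx, hy⟩ hz
    obtain ⟨h1, h2⟩ := Prod.mk.inj ((hD x y).symm.trans hz)
    obtain ⟨x', hx', y', hy', h3, h4⟩ := h n x y hx hy h1 (sub_eq_zero.1 h2)
    exact ⟨(x', y'), ⟨hx', hy'⟩, by rw [hD, h3, h4]⟩
  have hsplit : ∀ n, ∃ σ : (M × N) →ₗ[K] (M × N), (∀ z, σ z ∈ P n) ∧
      ∀ z ∈ P (n + 1), D z = 0 → D (σ z) = z := fun n => by
    obtain ⟨s, hs⟩ := (D.restrict (hDP n)).exists_comp_comp_eq_self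
    obtain ⟨s', hs'⟩ := s.exists_extend
    refine ⟨(P n).subtype ∘ₗ s', fun z => (s' z).2, fun z hz hdz => ?_⟩
    obtain ⟨w, hw, rfl⟩ := hexact n z hz hdz
    have h1 : s' (D w) = s ⟨D w, hz⟩ := LinearMap.congr_fun hs' ⟨D w, hz⟩
    have h2 := congrArg Subtype.val (LinearMap.congr_fun hs ⟨w, hw⟩)
    rw [LinearMap.comp_apply, h1]
    exact h2
  choose σ hσP hσ using hsplit
  -- The contraction `z ↦ σ (z - σ (D z))`, on `P (n + 1)`.
  let τ : ℤ → (M × N) →ₗ[K] (M × N) := fun n => σ n ∘ₗ (LinearMap.id - σ (n + 1) ∘ₗ D)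
  have hτP : ∀ n z, τ n z ∈ P n := fun n z => hσP _ _
  have hτ : ∀ n, ∀ z ∈ P (n + 1), D (τ n z) + τ (n + 1) (D z) = z := fun n z hz => by
    have h1 : D (σ (n + 1) (D z)) = D z := hσ _ _ (hDP _ _ hz) (hDD z)
    have h2 : D (τ n z) = z - σ (n + 1) (D z) :=
      hσ n _ (Submodule.sub_mem _ hz (hσP _ _)) (by
        change D (z - σ (n + 1) (D z)) = 0
        rw [map_sub, h1, sub_self])
    have h3 : τ (n + 1) (D z) = σ (n + 1) (D z) := by
      change σ (n + 1) (D z - σ (n + 1 + 1) (D (D z))) = _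
      rw [hDD, map_zero, sub_zero]
    rw [h2, h3, sub_add_cancel]
  -- `cM` and `cN` are the restrictions of the contraction to the two summands of the cone.
  let cM : M →ₗ[K] (M × N) := M.ofComponents fun i => τ (i - 1 - 1) ∘ₗ LinearMap.inl K M N
  let cN : N →ₗ[K] (M × N) := N.ofComponents fun i => τ (i - 1) ∘ₗ LinearMap.inr K M N
  have hcM : ∀ n, ∀ x ∈ M.gr (n + 1 + 1), cM x = τ n (x, 0) := fun n x hx => by
    have h1 := M.ofComponents_of_mem (fun i => τ (i - 1 - 1) ∘ₗ LinearMap.inl K M N) hx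
    simpa using h1
  have hcN : ∀ n, ∀ y ∈ N.gr (n + 1), cN y = τ n (0, y) := fun n y hy => by
    have h1 := N.ofComponents_of_mem (fun i => τ (i - 1) ∘ₗ LinearMap.inr K M N) hy
    simpa using h1
  have hM : ∀ x, D (cM x) + (cM (M.d x) + cN (φ x)) = (x, 0) := by
    refine LinearMap.congr_fun (f := D ∘ₗ cM + (cM ∘ₗ M.d + cN ∘ₗ φ))
      (g := LinearMap.inl K M N) (M.hom_ext fun i x hx => ?_)
    obtain ⟨n, rfl⟩ : ∃ n, i = n + 1 + 1 := ⟨i - 1 - 1, by ring⟩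
    have h1 := hτ n (x, 0) ⟨hx, Submodule.zero_mem _⟩
    have h2 : D (x, 0) = (M.d x, 0) + (0, φ x) := by simp [hD]
    rw [h2, map_add] at h1
    simp only [LinearMap.add_apply, LinearMap.comp_apply, LinearMap.inl_apply]
    rw [hcM n x hx, hcM (n + 1) _ (M.d_mem hx), hcN (n + 1) _ (hφ.map_mem hx), h1]
  have hN : ∀ y, D (cN y) - cN (N.d y) = (0, y) := by
    refine LinearMap.congr_fun (f := D ∘ₗ cN - cN ∘ₗ N.d)
      (g := LinearMap.inr K M N) (N.hom_ext fun i y hy => ?_)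
    obtain ⟨n, rfl⟩ : ∃ n, i = n + 1 := ⟨i - 1, by ring⟩
    have h1 := hτ n (0, y) ⟨Submodule.zero_mem _, hy⟩
    have h2 : D (0, y) = -(0, N.d y) := by simp [hD]
    rw [h2, map_neg, ← sub_eq_add_neg] at h1
    simp only [LinearMap.sub_apply, LinearMap.comp_apply, LinearMap.inr_apply]
    rw [hcN n y hy, hcN (n + 1) _ (N.d_mem hy), h1]
  have hM1 : ∀ x, M.d (cM x).1 + ((cM (M.d x)).1 + (cN (φ x)).1) = x :=
    fun x => congrArg Prod.fst (hM x)
  have hN1 : ∀ y, M.d (cN y).1 - (cN (N.d y)).1 = 0 := fun y => congrArg Prod.fst (hN y)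
  have hN2 : ∀ y, φ (cN y).1 - N.d (cN y).2 - (cN (N.d y)).2 = y :=
    fun y => congrArg Prod.snd (hN y)
  refine ⟨{
    inv := LinearMap.fst K M N ∘ₗ cN
    isChainMap := ⟨fun {n y} hy => ?_, fun y => (sub_eq_zero.1 (hN1 y)).symm⟩
    left := -(LinearMap.fst K M N ∘ₗ cM)
    left_mem := fun {n x} hx => ?_
    left_eq := fun x => ?_
    right := LinearMap.snd K M N ∘ₗ cN
    right_mem := fun {n y} hy => ?_
    right_eq := fun y => ?_ }⟩
  · obtain ⟨n, rfl⟩ : ∃ k, n = k + 1 := ⟨n - 1, by ring⟩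
    rw [LinearMap.comp_apply, hcN n y hy]
    exact (hτP n _).1
  · obtain ⟨n, rfl⟩ : ∃ k, n = k + 1 := ⟨n - 1, by ring⟩
    rw [LinearMap.neg_apply, LinearMap.comp_apply, hcM n x hx]
    exact Submodule.neg_mem _ (hτP n _).1
  · have h1 := hM1 x
    simp only [LinearMap.neg_apply, LinearMap.comp_apply, LinearMap.fst_apply, map_neg]
    nth_rewrite 2 [← h1]
    abel
  · rw [LinearMap.comp_apply, hcN n y hy]
    exact (hτP n _).2
  · have h1 := hN2 y
    simp only [LinearMap.comp_apply, LinearMap.fst_apply, LinearMap.snd_apply]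
    nth_rewrite 2 [← h1]
    abel

end Field

end DGMod

/-! ### From the vertical differential to the Hochschild differential -/

namespace DGBimod

variable {K : Type u} [CommRing K] {A B : DGAlg K}

theorem complex_d (M : DGBimod A) (n : ℤ) :
    M.complex.d n (n + 1) = ModuleCat.ofHom (M.delta n) := by
  simp only [complex, CochainComplex.of_d]

/-- The only dg bimodule over the zero algebra is zero. -/
theorem subsingleton [Subsingleton A] (M : DGBimod A) : Subsingleton M :=
  subsingleton_of_forall_eq 0 fun m => by
    rw [← M.r_one m, Subsingleton.elim (1 : A) 0, map_zero]

/-- A morphism of Hochschild cochain complexes that is given, in each tensor degree `m`, by a map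
with exact cone for the vertical differential is a quasi-isomorphism. Since `δ = δᵛ + δʰ` and `δʰ`
raises `m` by one, a relative cocycle can be bounded one tensor degree after the other, and no
convergence question arises because cochains are products over `m`. -/
theorem quasiIso_complexHom {M : DGBimod A} {N : DGBimod B}
    (φ : ∀ m, (A.bars m →ₗ[K] M) →ₗ[K] (B.bars m →ₗ[K] N))
    (φ_deltaH : ∀ m n f, φ (m + 1) (M.deltaH m n f) = N.deltaH m n (φ m f))
    (hφ : ∀ m, ConeExact (DGMod.homGr (A.bars m) M.toDGMod) (M.deltaV m)
      (DGMod.homGr (B.bars m) N.toDGMod) (N.deltaV m) (φ m))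
    (Φ : ∀ n, M.cochains n →ₗ[K] N.cochains n) (hΦ : ∀ n f m, (Φ n f).1 m = φ m (f.1 m))
    (hδ : ∀ n f, N.delta n (Φ n f) = Φ (n + 1) (M.delta n f)) :
    QuasiIso (complexHom Φ hδ) := by
  rw [CochainComplex.quasiIso_iff_cone_exact]
  simp only [complex_d]
  intro n (x : M.cochains (n + 1 + 1)) (y : N.cochains (n + 1))
    (hx : M.delta (n + 1 + 1) x = 0) (hxy : Φ (n + 1 + 1) x = N.delta (n + 1) y)
  have hx0 : M.deltaV 0 (n + 1 + 1) (x.1 0) = 0 := congrFun (congrArg Subtype.val hx) 0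
  have hxs : ∀ m, M.deltaV (m + 1) (n + 1 + 1) (x.1 (m + 1)) + M.deltaH m (n + 1 + 1) (x.1 m) = 0 :=
    fun m => congrFun (congrArg Subtype.val hx) (m + 1)
  have hy0 : φ 0 (x.1 0) = N.deltaV 0 (n + 1) (y.1 0) :=
    (hΦ _ x 0).symm.trans (congrFun (congrArg Subtype.val hxy) 0)
  have hys : ∀ m, φ (m + 1) (x.1 (m + 1)) =
      N.deltaV (m + 1) (n + 1) (y.1 (m + 1)) + N.deltaH m (n + 1) (y.1 m) := fun m =>
    (hΦ _ x (m + 1)).symm.trans (congrFun (congrArg Subtype.val hxy) (m + 1))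
  -- The property of the components of degree `m` that allows the next ones to be constructed.
  let P : ∀ m, (A.bars m →ₗ[K] M) × (B.bars m →ₗ[K] N) → Prop := fun m p =>
    M.IsHomog m (n + 1) p.1 ∧ N.IsHomog m n p.2 ∧
      M.deltaH m (n + 1 + 1) (M.deltaV m (n + 1) p.1) = M.deltaH m (n + 1 + 1) (x.1 m) ∧
      N.deltaH m (n + 1) (φ m p.1 - N.deltaV m n p.2) = N.deltaH m (n + 1) (y.1 m)
  have hbase : ∃ p, P 0 p ∧ M.deltaV 0 (n + 1) p.1 = x.1 0 ∧
      φ 0 p.1 - N.deltaV 0 n p.2 = y.1 0 := by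
    obtain ⟨ξ, hξ, η, hη, h1, h2⟩ := hφ 0 n (x.1 0) (y.1 0) (x.2 0) (y.2 0) hx0 hy0
    exact ⟨(ξ, η), ⟨hξ, hη, by rw [h1], by rw [h2]⟩, h1, h2⟩
  have hstep : ∀ m p, P m p → ∃ p', P (m + 1) p' ∧
      M.deltaV (m + 1) (n + 1) p'.1 + M.deltaH m (n + 1) p.1 = x.1 (m + 1) ∧
      φ (m + 1) p'.1 - (N.deltaV (m + 1) n p'.2 + N.deltaH m n p.2) = y.1 (m + 1) := by
    rintro m ⟨ξ, η⟩ ⟨hξ, hη, h1, h2⟩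
    have h3 := M.deltaV_deltaH m (n + 1) ξ hξ
    have h4 := N.deltaV_deltaH m n η hη
    rw [map_sub] at h2
    obtain ⟨ξ', hξ', η', hη', h5, h6⟩ := hφ (m + 1) n
      (x.1 (m + 1) - M.deltaH m (n + 1) ξ) (y.1 (m + 1) + N.deltaH m n η)
      (Submodule.sub_mem _ (x.2 (m + 1)) hξ.deltaH)
      (Submodule.add_mem _ (y.2 (m + 1)) hη.deltaH)
      (by rw [map_sub, eq_neg_of_add_eq_zero_left h3, h1, sub_neg_eq_add, hxs])
      (by
        rw [map_sub, φ_deltaH, map_add, hys, eq_neg_of_add_eq_zero_left h4, ← h2]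
        abel)
    refine ⟨(ξ', η'), ⟨hξ', hη', ?_, ?_⟩, ?_, ?_⟩
    · rw [h5, map_sub, deltaH_deltaH, sub_zero]
    · rw [h6, map_add, deltaH_deltaH, add_zero]
    · rw [h5, sub_add_cancel]
    · rw [← sub_sub, h6, add_sub_cancel_right]
  obtain ⟨p₀, hp₀, hp₀x, hp₀y⟩ := hbase
  choose F hFP hFx hFy using hstep
  let s : ∀ m, {p // P m p} := fun m => Nat.rec ⟨p₀, hp₀⟩ (fun m p => ⟨F m p.1 p.2, hFP m p.1 p.2⟩) m
  refine ⟨⟨fun m => (s m).1.1, fun m => (s m).2.1⟩, ⟨fun m => (s m).1.2, fun m => (s m).2.2.1⟩,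
    Subtype.ext (funext fun m => ?_), Subtype.ext (funext fun m => ?_)⟩
  · cases m with
    | zero => exact hp₀x
    | succ m => exact hFx m (s m).1 (s m).2
  · refine (congrArg (· - _) (hΦ (n + 1) _ m)).trans ?_
    cases m with
    | zero => exact hp₀y
    | succ m => exact hFy m (s m).1 (s m).2

end DGBimod

namespace DGMod

theorem toComplex_d {K : Type u} [CommRing K] (M : DGMod K) (n : ℤ) :
    M.toComplex.d n (n + 1) = ModuleCat.ofHom (M.d.restrict fun _ hx => M.d_mem hx) := by
  simp only [DGMod.toComplex, CochainComplex.of_d]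

end DGMod

/-! ### Differential forms and tensor powers of a quasi-isomorphism -/

namespace DGAlg

variable {K : Type u} [Field K] {A B : DGAlg K} (f : Hom A B)

theorem Hom.isChainMap_sbarMap : DGMod.IsChainMap f.sbarMap :=
  ⟨f.sbarMap_mem, fun v => by
    obtain ⟨x, rfl⟩ := A.bar_surjective v
    simp [d_bar, f.map_d]⟩

theorem Hom.isChainMap_barsMap (m : ℕ) : DGMod.IsChainMap (f.barsMap m) :=
  ⟨f.barsMap_mem m, f.barsMap_d m⟩

theorem Hom.isChainMap_omegaMap (p : ℕ) :
    DGMod.IsChainMap (M := (A.Omega p).toDGMod) (N := (B.Omega p).toDGMod) (f.omegaMap p).toLin :=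
  ⟨(f.omegaMap p).map_mem, (f.omegaMap p).map_d⟩

theorem Hom.IsQuasiIso.coneExact {f : Hom A B} (hf : f.IsQuasiIso) :
    ConeExact A.gr (fun _ => A.d) B.gr (fun _ => B.d) f.toAlgHom.toLinearMap := by
  intro n x y hx hy hdx hxy
  have h := (CochainComplex.quasiIso_iff_cone_exact _).1 hf
  simp only [DGMod.toComplex_d] at h
  obtain ⟨x', y', h1, h2⟩ := h n (⟨x, hx⟩ : A.gr (n + 1 + 1)) (⟨y, hy⟩ : B.gr (n + 1))
    (Subtype.ext hdx) (Subtype.ext hxy)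
  exact ⟨x'.1, x'.2, y'.1, y'.2, congrArg Subtype.val h1, congrArg Subtype.val h2⟩

theorem bar_eq_zero_iff (A : DGAlg K) (a : A) : A.bar a = 0 ↔ ∃ c : K, c • (1 : A) = a :=
  (Submodule.Quotient.mk_eq_zero _).trans Submodule.mem_span_singleton

/-- A multiple of `1` is homogeneous of degree zero, so it vanishes if it also has another degree. -/
theorem eq_zero_of_smul_one_mem (A : DGAlg K) {i : ℤ} (hi : i ≠ 0) {c : K}
    (h : c • (1 : A) ∈ A.gr i) : c • (1 : A) = 0 := by
  have h1 := (DirectSum.decompose_of_mem_same A.gr h).symm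
  rw [DirectSum.decompose_of_mem_ne A.gr (Submodule.smul_mem _ c A.one_mem) hi.symm] at h1
  exact h1

/-- If `B` is nonzero, then a quasi-isomorphism `A → B` induces a quasi-isomorphism
`s(A / K · 1) → s(B / K · 1)`. For `B = 0` this fails as soon as `A` is nonzero. -/
theorem Hom.coneExact_sbarMap [Nontrivial B] {f : Hom A B}
    (h : ConeExact A.gr (fun _ => A.d) B.gr (fun _ => B.d) f.toAlgHom.toLinearMap) :
    ConeExact A.sbar.gr (fun _ => A.sbar.d) B.sbar.gr (fun _ => B.sbar.d) f.sbarMap := by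
  rintro n _ _ ⟨x, hx, rfl⟩ ⟨y, hy, rfl⟩ hdx hxy
  change -A.bar (A.d x) = 0 at hdx
  change B.bar (f.toAlgHom x) = -B.bar (B.d y) at hxy
  -- `d x` is a multiple of `1`, and the multiple is zero because `f (d x)` bounds a scalar.
  rw [neg_eq_zero, bar_eq_zero_iff] at hdx
  obtain ⟨c, hc⟩ := hdx
  rw [eq_neg_iff_add_eq_zero, ← map_add, bar_eq_zero_iff] at hxy
  obtain ⟨c', hc'⟩ := hxy
  have h1 : c • (1 : B) = 0 := by
    have h2 := congrArg B.d hc'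
    rw [map_smul, B.d_one, smul_zero, map_add, B.d_d, add_zero, ← f.map_d, ← hc, map_smul,
      map_one] at h2
    exact h2.symm
  have h2 : A.d x = 0 := by
    rw [← hc, (smul_eq_zero.1 h1).resolve_right one_ne_zero, zero_smul]
  have h3 : c' • (1 : A) ∈ A.gr (n + 1 + 1 + 1) := by
    by_cases hn : n + 1 + 1 + 1 = 0
    · rw [hn]
      exact Submodule.smul_mem _ _ A.one_mem
    · have h4 : c' • (1 : B) ∈ B.gr (n + 1 + 1 + 1) :=
        hc' ▸ Submodule.add_mem _ (f.map_mem hx) (B.d_mem hy)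
      rw [(smul_eq_zero.1 (B.eq_zero_of_smul_one_mem hn h4)).resolve_right one_ne_zero, zero_smul]
      exact Submodule.zero_mem _
  obtain ⟨x', hx', y', hy', h4, h5⟩ := h (n + 1) (x - c' • 1) (-y) (Submodule.sub_mem _ hx h3)
    (Submodule.neg_mem _ hy) (by rw [map_sub, map_smul, A.d_one, smul_zero, sub_zero, h2])
    (by
      rw [AlgHom.toLinearMap_apply, map_sub, map_smul, map_one, hc', map_neg]
      abel)
  refine ⟨-A.bar x', Submodule.neg_mem _ ⟨x', hx', rfl⟩, B.bar y', ⟨y', hy', rfl⟩, ?_, ?_⟩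
  · rw [map_neg, A.d_bar, neg_neg, h4, map_sub, map_smul, A.bar_one, smul_zero, sub_zero]
    rfl
  · have h6 := congrArg B.bar h5
    rw [map_sub, map_neg, sub_eq_iff_eq_add] at h6
    rw [map_neg, B.d_bar, f.sbarMap_bar, sub_neg_eq_add]
    refine (congrArg (fun v => -v + B.bar (B.d y')) h6).trans ?_
    change _ = B.bar y
    abel

/-- The maps `s(A / K · 1)^{⊗ m} → s(B / K · 1)^{⊗ m}` are homotopy equivalences when the map for
`m = 1` is. -/
def Hom.homotopyInverseBarsMap (h : DGMod.HomotopyInverse f.sbarMap) :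
    ∀ m, DGMod.HomotopyInverse (f.barsMap m)
  | 0 => DGMod.HomotopyInverse.id (DGMod.unit K)
  | m + 1 => h.tmap (Hom.homotopyInverseBarsMap h m) (f.isChainMap_barsMap m)

/-- If `f : A → B` is a quasi-isomorphism, then each `Ω^p(f)` is a homotopy equivalence. For
`B = 0` both `Ω^p(A)` and `Ω^p(B)` are contractible. -/
theorem Hom.IsQuasiIso.nonempty_homotopyInverse_omegaMap {f : Hom A B} (hf : f.IsQuasiIso) :
    ∀ p, Nonempty (DGMod.HomotopyInverse (M := (A.Omega p).toDGMod) (N := (B.Omega p).toDGMod)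
      (f.omegaMap p).toLin)
  | 0 => DGMod.HomotopyInverse.nonempty_of_coneExact (f.isChainMap_omegaMap 0) hf.coneExact
  | p + 1 => by
    obtain ⟨h⟩ := Hom.IsQuasiIso.nonempty_homotopyInverse_omegaMap hf p
    cases subsingleton_or_nontrivial B with
    | inl hB =>
      have h1 : Subsingleton (B.Omega p) := DGBimod.subsingleton _
      have h2 : Subsingleton (B.Omega (p + 1)) := DGBimod.subsingleton _
      have h3 : Subsingleton (DGMod.tensor A.sbar (B.Omega p).toDGMod) :=
        (TensorProduct.uniqueRight (R := K) (M := A.sbar) (N := B.Omega p)).instSubsingleton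
      exact ⟨((DGMod.HomotopyInverse.id A.sbar).tmap h (f.isChainMap_omegaMap p)).ofSubsingleton
        (f.omegaMap (p + 1)).toLin⟩
    | inr hB =>
      obtain ⟨h'⟩ := DGMod.HomotopyInverse.nonempty_of_coneExact f.isChainMap_sbarMap
        (Hom.coneExact_sbarMap hf.coneExact)
      exact ⟨h'.tmap h (f.isChainMap_omegaMap p)⟩

/-! ### The singular Hochschild cochain complexes -/

theorem Hom.IsQuasiIso.quasiIso_formPush {f : Hom A B} (hf : f.IsQuasiIso) (p : ℕ) :
    QuasiIso (f.formPush p) := by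
  obtain ⟨h⟩ := hf.nonempty_homotopyInverse_omegaMap p
  exact DGBimod.quasiIso_complexHom (M := DGBimod.restrict (Hom.id A) (A.Omega p))
    (N := DGBimod.restrict f (B.Omega p))
    (fun m => LinearMap.llcomp K (A.bars m) (A.Omega p) (B.Omega p) (f.omegaMap p).toLin)
    (fun m n g => (DGBimod.deltaH_push (f.coeffMap p) m n g).symm)
    (fun m => h.coneExact_push (f.isChainMap_omegaMap p) (A.bars m)) _ (fun _ _ _ => rfl) _

theorem Hom.IsQuasiIso.quasiIso_formPull {f : Hom A B} (hf : f.IsQuasiIso) (p : ℕ) :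
    QuasiIso (f.formPull p) := by
  refine DGBimod.quasiIso_complexHom (M := DGBimod.restrict (Hom.id B) (B.Omega p))
    (N := DGBimod.restrict f (B.Omega p))
    (fun m => LinearMap.lcomp K (B.Omega p) (f.barsMap m))
    (fun m n g => (DGBimod.deltaH_pull f (B.Omega p) m n g).symm)
    (fun m => ?_) _ (fun _ _ _ => rfl) _
  cases subsingleton_or_nontrivial B with
  | inl hB =>
    have h1 : Subsingleton (B.Omega p) := DGBimod.subsingleton _
    intro n x y _ _ _ _
    exact ⟨0, Submodule.zero_mem _, 0, Submodule.zero_mem _,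
      LinearMap.ext fun _ => Subsingleton.elim (α := B.Omega p) _ _,
      LinearMap.ext fun _ => Subsingleton.elim (α := B.Omega p) _ _⟩
  | inr hB =>
    obtain ⟨h⟩ := DGMod.HomotopyInverse.nonempty_of_coneExact f.isChainMap_sbarMap
      (Hom.coneExact_sbarMap hf.coneExact)
    exact (f.homotopyInverseBarsMap h m).coneExact_pull (f.isChainMap_barsMap m)
      (B.Omega p).toDGMod

end DGAlg

end

theorem proposition7p4 {K : Type u} [Field K] (A B : DGAlg K) (f : DGAlg.Hom A B)
    (hf : f.IsQuasiIso) : QuasiIso f.CsgPush ∧ QuasiIso f.CsgPull :=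
  ⟨CochainComplex.quasiIso_colimMap _ hf.quasiIso_formPush,
    CochainComplex.quasiIso_colimMap _ hf.quasiIso_formPull⟩
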